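/- Theorem. All graphs are finite, simple and undirected. Let $G$ be a connected graph with a weight function $w: V(G) \to \mathbb{Z}^{+}$, and write $w(S)=\sum_{v\in S} w(v)$ for $S\subseteq V(G)$. A set $S \subseteq V(H)$ is a claw-deletion set of a graph $H$ if $H \setminus S$ has no induced subgraph isomorphic to the claw $K_{1,3}$. A cutpoint of $G$ is a vertex $v$ such that $G\setminus\{v\}$ has more connected components than $G$. A block of $G$ is a maximal subgraph that remains connected after the removal of any set of at most one vertex; blocks are identified with their vertex sets. Assume that $G$ is a block graph, i.e. every block is a clique, and that $G$ is not complete. Then $G$ has a cutpoint. Let $T$ be the block-cutpoint-tree of $G$: its nodes are the cutpoints and the blocks of $G$, and a cutpoint is adjacent to the blocks that contain it. Root $T$ at any cutpoint $r$. For a node $x$ of $T$, let $C(x)$ be the set of its children, $p(x)$ its parent (if $x \ne r$), and $T_x$ the subtree of $T$ rooted at $x$. Let $G_x$ be the subgraph of $G$ induced by the union of the blocks in $T_x$; for $x\neq r$ let $G_x^+$ be the subgraph of $G$ induced by the union of the blocks in $V(T_x) \cup \{p(x)\}$; for a block $b$ let $G_b^- = G_b \setminus \{p(b)\}$, and let $s(b)$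 be the sum of the weights of the vertices of $b$ that are not cutpoints of $G$. Define $f_1, f_2, f_3$ bottom-up on $T$ as follows. For a block $b$ with $C(b)=\emptyset$, let $f_1(b)=s(b)$ and $f_2(b)=f_3(b)=0$. For a block $b$ with $C(b)\neq\emptyset$, let $$f_1(b)=s(b)+\sum_{v\in C(b)} f_1(v),\qquad f_3(b)=\sum_{v\in C(b)}\min\{f_1(v),f_3(v)\},$$ $$f_2(b)=\min\Big\{\sum_{v\in C(b)}\min\{f_1(v),f_3(v)\},\ \min_{v_1\in C(b)}\Big(s(b)+f_2(v_1)+\sum_{v\in C(b)\setminus\{v_1\}} f_1(v)\Big)\Big\}.$$ For a cutpoint $v$, let $$f_1(v)=w(v)+\sum_{b\in C(v)} f_2(b),$$ $$f_2(v)=\sum_{b\in C(v)} f_3(b)\ \text{ if } |C(v)|\le 2,\qquad f_2(v)=\min_{b_1,b_2\in C(v)}\Big(\sum_{b\in\{b_1,b_2\}} f_3(b)+\sum_{b\in C(v)\setminus\{b_1,b_2\}} f_1(b)\Big)\ \text{ if } |C(v)|\ge 3,$$ and, for $v \neq r$, $$f_3(v)=f_3(b)\ \text{ if } C(v)=\{b\},\qquad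 f_3(v)=\min_{b_1\in C(v)}\Big(f_3(b_1)+\sum_{b\in C(v)\setminus\{b_1\}} f_1(b)\Big)\ \text{ if } |C(v)|\ge 2.$$ Then, for every cutpoint $v$ of $G$: - $f_1(v)$ is the minimum weight of a claw-deletion set of $G_v$ containing $v$; - $f_2(v)$ is the minimum weight of a claw-deletion set of $G_v$ not containing $v$; - if $v\ne r$, $f_3(v)$ is the minimum weight of a claw-deletion set of $G_v^+$ that contains neither $v$ nor all the vertices of $p(v)\setminus\{v\}$. For every block $b$ of $G$: - $f_1(b)$ is the minimum weight of a claw-deletion set of $G_b^-$ containing $b\setminus\{p(b)\}$; - $f_2(b)$ is the minimum weight of a claw-deletion set of $G_b^-$; - $f_3(b)$ is the minimum weight of a claw-deletion set of $G_b$ not containing $p(b)$. In particular, $f(r)=\min\{f_1(r),f_2(r)\}$ is the minimum weight of a claw-deletion set of $G$. -/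

import Mathlib

namespace ClawDeletion

universe u

/-! ### Claws and claw-deletion sets -/

/-- A graph is claw-free if it has no induced subgraph isomorphic to the claw `K_{1,3}`. -/
def IsClawFree {W : Type u} (H : SimpleGraph W) : Prop :=
  ¬ (completeBipartiteGraph (Fin 1) (Fin 3)).IsIndContained H

open scoped Classical in
/-- `S` is a claw-deletion set of the induced subgraph `G[U]`: `S` is a set of vertices of `G[U]`
and `G[U] \ S` is claw-free. -/
def IsClawDeletionSet {V : Type u} (G : SimpleGraph V) (U S : Finset V) : Prop :=
  S ⊆ U ∧ IsClawFree (G.induce (↑(U \ S) : Set V))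

/-- `m` is the minimum of the weights `w(S) = ∑ v ∈ S, w v` over all finite vertex sets `S` with
the property `P` (in particular the minimum exists). -/
def IsMinWeight {V : Type u} (w : V → ℕ) (P : Finset V → Prop) (m : ℕ) : Prop :=
  IsLeast {k : ℕ | ∃ S : Finset V, P S ∧ k = ∑ v ∈ S, w v} m

/-! ### Cutpoints, blocks and block graphs -/

/-- `v` is a cutpoint of `G` if `G \ {v}` has more connected components than `G`. -/
def IsCutpoint {V : Type u} (G : SimpleGraph V) (v : V) : Prop :=
  Nat.card G.ConnectedComponent < Nat.card (G.induce ({v}ᶜ : Set V)).ConnectedComponent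

open scoped Classical in
/-- `G[B]` is 2-connected, in the sense used for blocks: it stays connected (any two vertices are
joined by a path) after the removal of any set of at most one vertex.  In particular a single
vertex and a single edge have this property. -/
def IsTwoConnectedOn {V : Type u} (G : SimpleGraph V) (B : Finset V) : Prop :=
  ∀ X : Finset V, X.card ≤ 1 → (G.induce (↑(B \ X) : Set V)).Preconnected

/-- A block is a maximal 2-connected subgraph.  Such a subgraph is induced, so it is given by its
vertex set. -/
def IsBlock {V : Type u} (G : SimpleGraph V) (B : Finset V) : Prop :=
  Maximal (IsTwoConnectedOn G) B

/-- A block graph is a graph in which every block is a clique. -/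
def IsBlockGraph {V : Type u} (G : SimpleGraph V) : Prop :=
  ∀ B : Finset V, IsBlock G B → G.IsClique (↑B : Set V)

/-! ### The block-cutpoint-graph -/

/-- The nodes of the block-cutpoint-graph: the cutpoints of `G` and the blocks of `G`. -/
inductive BCNode {V : Type u} (G : SimpleGraph V) : Type u
  | cut (v : V) (h : IsCutpoint G v) : BCNode G
  | block (B : Finset V) (h : IsBlock G B) : BCNode G

/-- The vertices of `G` belonging to a node: `{v}` for a cutpoint `v`, and `B` for a block `B`. -/
def BCNode.verts {V : Type u} {G : SimpleGraph V} : BCNode G → Finset V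
  | .cut v _ => {v}
  | .block B _ => B

theorem finite_bcNode {V : Type u} [Fintype V] (G : SimpleGraph V) : Finite (BCNode G) := by
  let e : BCNode G → V ⊕ Finset V := fun x => match x with
    | .cut v _ => Sum.inl v
    | .block B _ => Sum.inr B
  refine Finite.of_injective e ?_
  rintro (⟨v, h⟩ | ⟨B, h⟩) (⟨v', h'⟩ | ⟨B', h'⟩) hx <;> simp_all [e]

noncomputable instance {V : Type u} [Fintype V] (G : SimpleGraph V) : Fintype (BCNode G) :=
  @Fintype.ofFinite _ (finite_bcNode G)

/-- The block-cutpoint-graph of `G`: a cutpoint is adjacent to a block whenever it belongs to it.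
For a connected graph this is a tree. -/
def blockCutpointGraph {V : Type u} (G : SimpleGraph V) : SimpleGraph (BCNode G) where
  Adj x y := match x, y with
    | .cut v _, .block B _ => v ∈ B
    | .block B _, .cut v _ => v ∈ B
    | _, _ => False
  symm := by
    constructor
    rintro (⟨v, h⟩ | ⟨B, h⟩) (⟨v', h'⟩ | ⟨B', h'⟩) hx <;> simp_all
  loopless := by
    constructor
    rintro (⟨v, h⟩ | ⟨B, h⟩) hx <;> simp_all

/-! ### Rooted trees -/

/-- In the tree `T` rooted at `ρ`, the node `y` is a child of `x`. -/
def IsChild {N : Type u} (T : SimpleGraph N) (ρ x y : N) : Prop :=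
  T.Adj x y ∧ T.dist ρ y = T.dist ρ x + 1

open scoped Classical in
/-- The set `C_T(x)` of the children of `x` in the tree `T` rooted at `ρ`. -/
noncomputable def children {N : Type u} [Fintype N] (T : SimpleGraph N) (ρ x : N) : Finset N :=
  {y | IsChild T ρ x y}

open scoped Classical in
/-- The parent `p_T(y)` of a node `y` other than the root (with the value `y` if there is none,
that is, for the root). -/
noncomputable def parent {N : Type u} (T : SimpleGraph N) (ρ y : N) : N :=
  if h : ∃ x, IsChild T ρ x y then h.choose else y

/-- The node set of the subtree `T_x`: the node `x` and all its descendants. -/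
def subtree {N : Type u} (T : SimpleGraph N) (ρ x : N) : Set N :=
  {y | Relation.ReflTransGen (IsChild T ρ) x y}

/-- The distance of `x` from the deepest level of `T` rooted at `ρ`; it decreases from a node to
its children. -/
noncomputable def coheight {N : Type u} [Fintype N] (T : SimpleGraph N) (ρ x : N) : ℕ :=
  (Finset.univ.sup fun y => T.dist ρ y) - T.dist ρ x

theorem coheight_lt {N : Type u} [Fintype N] {T : SimpleGraph N} {ρ x y : N}
    (h : y ∈ children T ρ x) : coheight T ρ y < coheight T ρ x := by
  have h1 : T.dist ρ y = T.dist ρ x + 1 := by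
    simp only [children, Finset.mem_filter] at h
    exact h.2.2
  have h2 : T.dist ρ y ≤ Finset.univ.sup fun z => T.dist ρ z :=
    Finset.le_sup (f := fun z => T.dist ρ z) (Finset.mem_univ y)
  unfold coheight
  omega

/-! ### The subgraphs attached to the nodes -/

section Subgraphs

variable {V : Type u} [Fintype V] (G : SimpleGraph V) (ρ : BCNode G)

open scoped Classical in
/-- The vertex set of the subgraph of `G` induced by the blocks in a set `A` of nodes. -/
noncomputable def vertsOf (A : Set (BCNode G)) : Finset V :=
  {u | ∃ (B : Finset V) (h : IsBlock G B), BCNode.block B h ∈ A ∧ u ∈ B}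

/-- The vertex set of `G_x`, the subgraph induced by the blocks in `T_x`. -/
noncomputable def below (x : BCNode G) : Finset V :=
  vertsOf G (subtree (blockCutpointGraph G) ρ x)

/-- The vertex set of `G_x^+`, the subgraph induced by the blocks in `T_x^+`, that is, in `T_x`
together with the parent of `x`. -/
noncomputable def belowPlus (x : BCNode G) : Finset V :=
  vertsOf G (insert (parent (blockCutpointGraph G) ρ x) (subtree (blockCutpointGraph G) ρ x))

/-- The vertices of `G` belonging to the parent of `x`: the vertex set of the block `p_T(x)` if
`x` is a cutpoint, and the singleton of the cutpoint `p_T(x)` if `x` is a block. -/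
noncomputable def parentVerts (x : BCNode G) : Finset V :=
  (parent (blockCutpointGraph G) ρ x).verts

open scoped Classical in
/-- The vertex set of `G_x^- = G_x \ {p_T(x)}`, for a block `x`. -/
noncomputable def belowMinus (x : BCNode G) : Finset V :=
  below G ρ x \ parentVerts G ρ x

end Subgraphs

/-! ### The recurrences -/

/-- The triple of values `f₁`, `f₂`, `f₃` at a node. -/
structure Values where
  f₁ : ℕ
  f₂ : ℕ
  f₃ : ℕ

section Recurrences

variable {V : Type u} [Fintype V] (G : SimpleGraph V) (w : V → ℕ) (ρ : BCNode G)

open scoped Classical in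
/-- `s(B)`: the sum of the weights of the vertices of `B` that are not cutpoints of `G`. -/
noncomputable def simplicialWeight (B : Finset V) : ℕ :=
  ∑ u ∈ B with ¬ IsCutpoint G u, w u

open scoped Classical in
/-- The right-hand sides of the recurrences at a node, where `F` supplies the values at its
children.  Every `sInf` is the minimum of a nonempty finite set of natural numbers: a cutpoint
always has a child. -/
noncomputable def step (F : BCNode G → Values) (x : BCNode G) : Values :=
  let C : Finset (BCNode G) := children (blockCutpointGraph G) ρ x
  match x with
  | .cut v _ =>
    { f₁ := w v + ∑ b ∈ C, (F b).f₂
      f₂ :=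
        if C.card ≤ 2 then ∑ b ∈ C, (F b).f₃
        else sInf {m | ∃ b₁ ∈ C, ∃ b₂ ∈ C,
          m = ∑ b ∈ {b₁, b₂}, (F b).f₃ + ∑ b ∈ C \ {b₁, b₂}, (F b).f₁}
      f₃ :=
        if C.card = 1 then ∑ b ∈ C, (F b).f₃
        else sInf {m | ∃ b₁ ∈ C, m = (F b₁).f₃ + ∑ b ∈ C \ {b₁}, (F b).f₁} }
  | .block B _ =>
    if C = ∅ then
      { f₁ := simplicialWeight G w B
        f₂ := 0
        f₃ := 0 }
    else
      { f₁ := simplicialWeight G w B + ∑ v ∈ C, (F v).f₁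
        f₂ := min (∑ v ∈ C, min (F v).f₁ (F v).f₃)
          (sInf {m | ∃ v₁ ∈ C,
            m = simplicialWeight G w B + (F v₁).f₂ + ∑ v ∈ C \ {v₁}, (F v).f₁})
        f₃ := ∑ v ∈ C, min (F v).f₁ (F v).f₃ }

open scoped Classical in
/-- The values `f₁`, `f₂`, `f₃` computed bottom-up on the block-cutpoint-tree rooted at `ρ`. -/
noncomputable def values (x : BCNode G) : Values :=
  step G w ρ
    (fun y => if _h : y ∈ children (blockCutpointGraph G) ρ x then values y else ⟨0, 0, 0⟩) x
termination_by coheight (blockCutpointGraph G) ρ x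
decreasing_by exact coheight_lt _h

/-- `values` satisfies the recurrences. -/
theorem values_eq (x : BCNode G) : values G w ρ x = step G w ρ (values G w ρ) x := by
  classical
  have key : ∀ F F' : BCNode G → Values,
      (∀ y ∈ children (blockCutpointGraph G) ρ x, F y = F' y) →
      step G w ρ F x = step G w ρ F' x := by
    intro F F' hF
    have hsub : ∀ (A : Finset (BCNode G)) (g : Values → ℕ),
        A ⊆ children (blockCutpointGraph G) ρ x → ∑ y ∈ A, g (F y) = ∑ y ∈ A, g (F' y) :=
      fun A g hA => Finset.sum_congr rfl fun y hy => by rw [hF y (hA hy)]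
    have hpair : ∀ b₁ ∈ children (blockCutpointGraph G) ρ x,
        ∀ b₂ ∈ children (blockCutpointGraph G) ρ x,
        ({b₁, b₂} : Finset (BCNode G)) ⊆ children (blockCutpointGraph G) ρ x := by
      intro b₁ h₁ b₂ h₂ y hy
      simp only [Finset.mem_insert, Finset.mem_singleton] at hy
      rcases hy with rfl | rfl <;> assumption
    have hset : ∀ (c : ℕ) (g : Values → ℕ),
        {m | ∃ v ∈ children (blockCutpointGraph G) ρ x,
          m = c + g (F v) + ∑ y ∈ children (blockCutpointGraph G) ρ x \ {v}, (F y).f₁} =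
        {m | ∃ v ∈ children (blockCutpointGraph G) ρ x,
          m = c + g (F' v) + ∑ y ∈ children (blockCutpointGraph G) ρ x \ {v}, (F' y).f₁} := by
      intro c g
      ext m
      refine exists_congr fun v => and_congr_right fun hv => ?_
      rw [hF v hv, hsub _ Values.f₁ Finset.sdiff_subset]
    have hset₂ :
        {m | ∃ b₁ ∈ children (blockCutpointGraph G) ρ x,
          ∃ b₂ ∈ children (blockCutpointGraph G) ρ x,
          m = ∑ b ∈ {b₁, b₂}, (F b).f₃ +
            ∑ b ∈ children (blockCutpointGraph G) ρ x \ {b₁, b₂}, (F b).f₁} =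
        {m | ∃ b₁ ∈ children (blockCutpointGraph G) ρ x,
          ∃ b₂ ∈ children (blockCutpointGraph G) ρ x,
          m = ∑ b ∈ {b₁, b₂}, (F' b).f₃ +
            ∑ b ∈ children (blockCutpointGraph G) ρ x \ {b₁, b₂}, (F' b).f₁} := by
      ext m
      refine exists_congr fun b₁ => and_congr_right fun h₁ =>
        exists_congr fun b₂ => and_congr_right fun h₂ => ?_
      rw [hsub _ Values.f₃ (hpair b₁ h₁ b₂ h₂), hsub _ Values.f₁ Finset.sdiff_subset]
    have hset₃ := hset 0 Values.f₃
    simp only [zero_add] at hset₃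
    have e₁ := hsub _ Values.f₁ (Finset.Subset.refl _)
    have e₂ := hsub _ Values.f₂ (Finset.Subset.refl _)
    have e₃ := hsub _ Values.f₃ (Finset.Subset.refl _)
    have e₄ := hsub _ (fun z => min z.f₁ z.f₃) (Finset.Subset.refl _)
    cases x with
    | cut v hv => simp only [step, e₂, e₃, hset₂, hset₃]
    | block B hB => simp only [step, e₁, e₄, hset _ Values.f₂]
  rw [values]
  refine key _ _ fun y hy => ?_
  simp [hy]

end Recurrences

end ClawDeletion

open ClawDeletion

/-! In a block graph two distinct blocks share at most one vertex, and such a vertex separates them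
(`IsBlock.eq_of_mem_of_mem`, `not_joinedAvoiding_of_ne`). The neighbourhood of a vertex `v` is
therefore a union of cliques, one for each block through `v`, with no edges between different ones.
So a vertex `v` outside `S` is the centre of a claw of `G \ S` exactly when at least three blocks
through `v` keep a further vertex (`clawAt_of_blocks`, `not_clawAt_of_cliques`).

The tree `T` cuts `G` into pieces over which weights add. Without `v`, the graph `G_v` is the
disjoint union of the `G_b^-` for the child blocks `b` (`below_cut_eq`); `G_b^-` is the disjoint
union of the non-cutpoints of `b` and the `G_v` for the child cutpoints `v`
(`below_block_sdiff_eq`). Edges leave a piece only through the vertex at which it is attached, so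
claws away from that vertex can be tested inside the piece.

At a cutpoint `v`: if `v` is deleted, the pieces are independent and cost `f₂(b)`. If `v` is kept,
at most two child blocks may keep a further vertex, at cost `f₃(b)`, and the others lose all of
theirs, at cost `f₁(b)`; for `f₃(v)` the parent block occupies one of the two places. Since `f₃(b) ≤
f₁(b)`, using every available place is optimal. This is `cutCorrect_step`.

At a block `b`: a kept child `v` with another survivor in `b` costs `f₃(v)` and a deleted one costs
`f₁(v)`, so the children are independent. If `p(b)` is kept it is such a survivor; if not, the one
remaining case is a child that is the sole survivor of `b`, at cost `f₂(v)`. This is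
`blockCorrect_step`. Induction up the tree (`nodeCorrect_values`) concludes; that `T` is a rooted
tree is `isRootedTree_blockCutpointGraph`. -/

namespace ClawDeletion

universe u

/-! ### Rooted trees given by the distance from the root -/

/-- The graph `T` is a tree when rooted at `ρ`, in terms of the relation `IsChild`: every edge joins
a parent to a child, every node has at most one parent, and every node descends from `ρ`. -/
structure IsRootedTree {N : Type u} (T : SimpleGraph N) (ρ : N) : Prop where
  adj : ∀ x y, T.Adj x y → IsChild T ρ x y ∨ IsChild T ρ y x
  unique : ∀ x x' y, IsChild T ρ x y → IsChild T ρ x' y → x = x'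
  reach : ∀ x, Relation.ReflTransGen (IsChild T ρ) ρ x

section RootedTree

variable {N : Type u} {T : SimpleGraph N} {ρ : N}

/-- A function `φ` that changes by one along edges, vanishes at `ρ` and decreases along some edge
from every node where it is positive, is the distance from `ρ`. -/
theorem dist_eq_of_potential {φ : N → ℕ} (h0 : ∀ x, φ x = 0 ↔ x = ρ)
    (hadj : ∀ x y, T.Adj x y → φ y = φ x + 1 ∨ φ x = φ y + 1)
    (hdown : ∀ x, 0 < φ x → ∃ y, T.Adj y x ∧ φ x = φ y + 1) (x : N) :
    T.dist ρ x = φ x ∧ T.Reachable ρ x := by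
  have lower : ∀ {a b : N} (p : T.Walk a b), φ b ≤ φ a + p.length := by
    intro a b p
    induction p with
    | nil => simp
    | cons h p ih =>
      have := hadj _ _ h
      simp only [SimpleGraph.Walk.length_cons]
      omega
  have upper : ∀ (n : ℕ) (x : N), φ x = n → ∃ p : T.Walk ρ x, p.length = n := by
    intro n
    induction n with
    | zero =>
      intro x hx
      obtain rfl := (h0 x).1 hx
      exact ⟨.nil, rfl⟩
    | succ n ih =>
      intro x hx
      obtain ⟨y, hy, hxy⟩ := hdown x (by omega)
      obtain ⟨p, hp⟩ := ih y (by omega)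
      exact ⟨p.concat hy, by simp [hp]⟩
  obtain ⟨p, hp⟩ := upper _ x rfl
  have hr : T.Reachable ρ x := ⟨p⟩
  obtain ⟨q, hq⟩ := hr.exists_walk_length_eq_dist
  have h1 := lower q
  have h2 := SimpleGraph.dist_le p
  have h3 := (h0 ρ).2 rfl
  exact ⟨by omega, hr⟩

/-- An explicit candidate for the distance from the root is enough to recognise a rooted tree;
cycles need not be excluded directly. -/
theorem IsRootedTree.of_potential {φ : N → ℕ} (h0 : ∀ x, φ x = 0 ↔ x = ρ)
    (hadj : ∀ x y, T.Adj x y → φ y = φ x + 1 ∨ φ x = φ y + 1)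
    (hdown : ∀ x, 0 < φ x → ∃ y, T.Adj y x ∧ φ x = φ y + 1)
    (huniq : ∀ x x' y, T.Adj x y → T.Adj x' y → φ y = φ x + 1 → φ y = φ x' + 1 → x = x') :
    IsRootedTree T ρ := by
  have hd : ∀ x, T.dist ρ x = φ x := fun x => (dist_eq_of_potential h0 hadj hdown x).1
  refine ⟨fun x y h => ?_, fun x x' y h h' => ?_, ?_⟩
  · rcases hadj x y h with h1 | h1
    · exact .inl ⟨h, by rw [hd, hd, h1]⟩
    · exact .inr ⟨h.symm, by rw [hd, hd, h1]⟩
  · exact huniq x x' y h.1 h'.1 (by rw [← hd, ← hd, h.2]) (by rw [← hd, ← hd, h'.2])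
  · have key : ∀ (n : ℕ) (x : N), φ x = n → Relation.ReflTransGen (IsChild T ρ) ρ x := by
      intro n
      induction n with
      | zero =>
        intro x hx
        obtain rfl := (h0 x).1 hx
        exact .refl
      | succ n ih =>
        intro x hx
        obtain ⟨y, hy, hxy⟩ := hdown x (by omega)
        exact (ih y (by omega)).tail ⟨hy, by rw [hd, hd, hxy]⟩
    exact fun x => key _ x rfl

theorem mem_subtree_self (x : N) : x ∈ subtree T ρ x := Relation.ReflTransGen.refl

theorem subtree_trans {x y z : N} (hxy : y ∈ subtree T ρ x) (hyz : z ∈ subtree T ρ y) :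
    z ∈ subtree T ρ x :=
  Relation.ReflTransGen.trans hxy hyz

theorem IsChild.mem_subtree {x y : N} (h : IsChild T ρ x y) : y ∈ subtree T ρ x :=
  Relation.ReflTransGen.single h

theorem mem_subtree_iff {x z : N} :
    z ∈ subtree T ρ x ↔ z = x ∨ ∃ y, IsChild T ρ x y ∧ z ∈ subtree T ρ y := by
  constructor
  · intro h
    rcases Relation.ReflTransGen.cases_head h with h | ⟨y, h1, h2⟩
    · exact .inl h.symm
    · exact .inr ⟨y, h1, h2⟩
  · rintro (rfl | ⟨y, h1, h2⟩)
    · exact mem_subtree_self _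
    · exact subtree_trans h1.mem_subtree h2

theorem dist_le_of_mem_subtree {x y : N} (h : y ∈ subtree T ρ x) : T.dist ρ x ≤ T.dist ρ y := by
  induction h with
  | refl => exact le_rfl
  | tail _ h ih => have := h.2; omega

theorem IsChild.notMem_subtree {x y : N} (h : IsChild T ρ x y) : x ∉ subtree T ρ y := by
  intro hx
  have := dist_le_of_mem_subtree hx
  have := h.2
  omega

theorem mem_children [Fintype N] {x y : N} : y ∈ children T ρ x ↔ IsChild T ρ x y := by
  simp [children]

namespace IsRootedTree

variable (hT : IsRootedTree T ρ)
include hT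

/-- A neighbour of a node of a subtree lies in the subtree, or is the parent of its root. -/
theorem mem_subtree_of_adj {x y z : N} (h : T.Adj y z) (hy : y ∈ subtree T ρ x) :
    z ∈ subtree T ρ x ∨ (y = x ∧ IsChild T ρ z x) := by
  rcases hT.adj y z h with h1 | h1
  · exact .inl (subtree_trans hy h1.mem_subtree)
  · rcases Relation.ReflTransGen.cases_tail hy with h2 | ⟨y', h2, h3⟩
    · subst h2
      exact .inr ⟨rfl, h1⟩
    · obtain rfl := hT.unique _ _ _ h1 h3
      exact .inl h2

/-- Parents are unique, so the ancestors of `z` form a chain and one sibling would descend from the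
other, hence their common parent would descend from its own child. -/
theorem disjoint_subtree {p x y z : N} (hx : IsChild T ρ p x) (hy : IsChild T ρ p y)
    (hxy : x ≠ y) (hzx : z ∈ subtree T ρ x) : z ∉ subtree T ρ y := by
  intro hzy
  have key : ∀ {x y : N}, IsChild T ρ p x → IsChild T ρ p y → x ≠ y →
      x ∉ subtree T ρ y := by
    intro x y hx hy hxy h
    rcases Relation.ReflTransGen.cases_tail h with h2 | ⟨y', h2, h3⟩
    · exact hxy h2
    · obtain rfl := hT.unique _ _ _ hx h3
      exact hy.notMem_subtree h2
  -- Going upwards is a partial function, so any two ancestors of `z` are comparable.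
  have hU : Relator.RightUnique (Function.swap (IsChild T ρ)) :=
    fun a b c hb hc => hT.unique _ _ _ hb hc
  rcases Relation.ReflTransGen.total_of_right_unique hU hzx.swap hzy.swap with h | h
  · exact key hx hy hxy (Relation.reflTransGen_swap.1 h)
  · exact key hy hx hxy.symm (Relation.reflTransGen_swap.1 h)

theorem parent_eq {x y : N} (h : IsChild T ρ x y) : parent T ρ y = x := by
  have h' : ∃ x, IsChild T ρ x y := ⟨x, h⟩
  unfold parent
  rw [dif_pos h']
  exact hT.unique _ _ _ h'.choose_spec h

theorem exists_isChild {x : N} (h : x ≠ ρ) : ∃ p, IsChild T ρ p x := by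
  rcases Relation.ReflTransGen.cases_tail (hT.reach x) with h2 | ⟨y, -, h3⟩
  · exact absurd h2 h
  · exact ⟨y, h3⟩

end IsRootedTree

end RootedTree

/-! ### Claws at a vertex -/

section Claws

variable {V : Type u} {G : SimpleGraph V}

/-- The vertex `u` has three pairwise nonadjacent neighbours in `A`. -/
def ClawAt (G : SimpleGraph V) (A : Finset V) (u : V) : Prop :=
  ∃ f : Fin 3 → V, Function.Injective f ∧ (∀ i, f i ∈ A ∧ G.Adj u (f i)) ∧
    ∀ i j, ¬ G.Adj (f i) (f j)

/-- No vertex of `A` is the centre of a claw of `G[A]`. -/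
def ClawFreeOn (G : SimpleGraph V) (A : Finset V) : Prop :=
  ∀ u ∈ A, ¬ ClawAt G A u

/-- Only neighbours of `u` have to be transferred, and `u` itself need not lie in either set. This
is what moves a claw between `G` and a piece containing the neighbourhood of its centre. -/
theorem ClawAt.mono {A A' : Finset V} {u : V} (h : ClawAt G A u)
    (hA : ∀ z ∈ A, G.Adj u z → z ∈ A') : ClawAt G A' u := by
  obtain ⟨f, h1, h2, h3⟩ := h
  exact ⟨f, h1, fun i => ⟨hA _ (h2 i).1 (h2 i).2, (h2 i).2⟩, h3⟩

theorem ClawFreeOn.mono {A A' : Finset V} (h : ClawFreeOn G A') (hA : A ⊆ A') : ClawFreeOn G A :=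
  fun u hu hc => h u (hA hu) (hc.mono fun _ hz _ => hA hz)

theorem isClawFree_induce_iff {A : Finset V} :
    IsClawFree (G.induce (↑A : Set V)) ↔ ClawFreeOn G A := by
  constructor
  · intro h u hu hc
    obtain ⟨f, h1, h2, h3⟩ := hc
    refine h ⟨⟨⟨fun x => Sum.elim (fun _ => ⟨u, hu⟩) (fun i => ⟨f i, (h2 i).1⟩) x, ?_⟩, ?_⟩⟩
    · rintro (a | a) (b | b) hab
      · exact congrArg Sum.inl (Subsingleton.elim _ _)
      · exact absurd (congrArg Subtype.val hab) (h2 b).2.ne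
      · exact absurd (congrArg Subtype.val hab) (h2 a).2.ne'
      · exact congrArg Sum.inr (h1 (congrArg Subtype.val hab))
    · rintro (a | a) (b | b)
      · change G.Adj u u ↔ _
        simp
      · change G.Adj u (f b) ↔ _
        simpa using (h2 b).2
      · change G.Adj (f a) u ↔ _
        simpa using (h2 a).2.symm
      · change G.Adj (f a) (f b) ↔ _
        simpa using h3 a b
  · rintro h ⟨e⟩
    refine h (e (Sum.inl 0)) (e (Sum.inl 0)).2 ⟨fun i => e (Sum.inr i), ?_, fun i => ⟨?_, ?_⟩, ?_⟩
    · intro i j hij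
      exact Sum.inr_injective (e.injective (Subtype.ext hij))
    · exact (e (Sum.inr i)).2
    · have := e.map_rel_iff (a := Sum.inl 0) (b := Sum.inr i)
      simpa using this
    · intro i j
      have := e.map_rel_iff (a := Sum.inr i) (b := Sum.inr j)
      simpa using this

/-- A vertex whose neighbours in `A` are covered by at most two cliques is not the centre of a
claw. -/
theorem not_clawAt_of_cliques {ι : Type*} {A : Finset V} {u : V} (K : Finset ι)
    (Q : ι → Finset V) (hK : K.card ≤ 2) (hQ : ∀ i ∈ K, G.IsClique (↑(Q i) : Set V))
    (hA : ∀ z ∈ A, G.Adj u z → ∃ i ∈ K, z ∈ Q i) : ¬ ClawAt G A u := by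
  rintro ⟨f, h1, h2, h3⟩
  choose g hg hg' using fun i => hA _ (h2 i).1 (h2 i).2
  -- Pigeonhole: two leaves in one clique would be adjacent, so three leaves need three cliques.
  have hinj : Set.InjOn g (Finset.univ : Finset (Fin 3)) := by
    intro i _ j _ hij
    by_contra hne
    exact h3 i j (hQ _ (hg i) (hg' i) (by rw [hij]; exact hg' j) (h1.ne hne))
  have := Finset.card_le_card_of_injOn g (fun i _ => hg i) hinj
  simp at this
  omega

end Claws

/-! ### Minimum weights -/

section Weights

variable {V : Type u} {w : V → ℕ} {P : Finset V → Prop} {m : ℕ}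

theorem isMinWeight_of (h : ∃ S, P S ∧ ∑ v ∈ S, w v ≤ m) (h' : ∀ S, P S → m ≤ ∑ v ∈ S, w v) :
    IsMinWeight w P m := by
  obtain ⟨S, hS, hm⟩ := h
  refine ⟨⟨S, hS, le_antisymm (h' S hS) hm⟩, ?_⟩
  rintro _ ⟨S, hS, rfl⟩
  exact h' S hS

theorem IsMinWeight.le (h : IsMinWeight w P m) {S : Finset V} (hS : P S) : m ≤ ∑ v ∈ S, w v :=
  h.2 ⟨S, hS, rfl⟩

theorem IsMinWeight.exists_le (h : IsMinWeight w P m) : ∃ S, P S ∧ ∑ v ∈ S, w v ≤ m := by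
  obtain ⟨S, hS, hm⟩ := h.1
  exact ⟨S, hS, hm.ge⟩

open scoped Classical in
theorem sum_inter_biUnion {ι : Type*} (C : Finset ι) (D : ι → Finset V)
    (hD : ∀ x ∈ C, ∀ y ∈ C, ∀ z, z ∈ D x → z ∈ D y → x = y) (S : Finset V) :
    ∑ y ∈ C, ∑ v ∈ S ∩ D y, w v = ∑ v ∈ S ∩ C.biUnion D, w v := by
  rw [Finset.inter_biUnion, Finset.sum_biUnion]
  intro x hx y hy hxy
  rw [Function.onFun, Finset.disjoint_left]
  intro z hz hz'
  exact hxy (hD x hx y hy z (Finset.mem_inter.1 hz).2 (Finset.mem_inter.1 hz').2)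

end Weights

/-! ### Blocks of a block graph -/

section Blocks

variable {V : Type u} {G : SimpleGraph V}

/-- The vertices `a` and `b` are joined by a walk that avoids `v`. -/
def JoinedAvoiding (G : SimpleGraph V) (v a b : V) : Prop :=
  ∃ p : G.Walk a b, v ∉ p.support

theorem JoinedAvoiding.refl {v a : V} (h : v ≠ a) : JoinedAvoiding G v a a :=
  ⟨.nil, by simpa using h⟩

theorem JoinedAvoiding.symm {v a b : V} (h : JoinedAvoiding G v a b) : JoinedAvoiding G v b a := by
  obtain ⟨p, hp⟩ := h
  exact ⟨p.reverse, by simpa using hp⟩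

theorem JoinedAvoiding.trans {v a b c : V} (h : JoinedAvoiding G v a b)
    (h' : JoinedAvoiding G v b c) : JoinedAvoiding G v a c := by
  obtain ⟨p, hp⟩ := h
  obtain ⟨q, hq⟩ := h'
  exact ⟨p.append q, by simp [SimpleGraph.Walk.mem_support_append_iff, hp, hq]⟩

theorem JoinedAvoiding.of_adj {v a b : V} (hab : G.Adj a b) (ha : v ≠ a) (hb : v ≠ b) :
    JoinedAvoiding G v a b :=
  ⟨hab.toWalk, by simp [ha, hb]⟩

open scoped Classical in
/-- A path together with a vertex adjacent to both of its ends is 2-connected. -/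
theorem isTwoConnectedOn_insert_support {v a b : V} (p : G.Walk a b) (hp : p.IsPath)
    (hv : v ∉ p.support) (ha : G.Adj v a) (hb : G.Adj v b) :
    IsTwoConnectedOn G (insert v p.support.toFinset) := by
  intro X hX
  set s : Set V := ↑(insert v p.support.toFinset \ X) with hs
  have hmem : ∀ {y}, y ∈ s ↔ (y = v ∨ y ∈ p.support) ∧ y ∉ X := by
    intro y
    simp [hs]
  have lift : ∀ {x y : V} (hx : x ∈ s) (hy : y ∈ s) (q : G.Walk x y), (∀ z ∈ q.support, z ∈ s) →
      (G.induce s).Reachable ⟨x, hx⟩ ⟨y, hy⟩ := fun _ _ q h => ⟨q.induce s h⟩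
  have hone : ∀ {x y}, x ∈ X → y ∈ X → x = y :=
    fun hx hy => Finset.card_le_one.1 hX _ hx _ hy
  -- It is enough to find one hub `c` that reaches every remaining vertex.
  suffices h : ∃ (c : V) (hc : c ∈ s), ∀ (y : V) (hy : y ∈ s),
      (G.induce s).Reachable ⟨c, hc⟩ ⟨y, hy⟩ by
    obtain ⟨c, hc, h⟩ := h
    exact fun x y => (h x.1 x.2).symm.trans (h y.1 y.2)
  by_cases hvX : v ∈ X
  · have hsup : ∀ z ∈ p.support, z ∈ s :=
      fun z hz => hmem.2 ⟨.inr hz, fun hzX => hv (hone hzX hvX ▸ hz)⟩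
    refine ⟨a, hsup a p.start_mem_support, fun y hy => ?_⟩
    have hyp : y ∈ p.support := (hmem.1 hy).1.resolve_left fun h => (hmem.1 hy).2 (h ▸ hvX)
    exact lift _ _ (p.takeUntil y hyp) fun z hz =>
      hsup z (p.support_takeUntil_subset_support hyp hz)
  -- With `v` present it is the hub: `y` is reached along the path from the end `a`, or from the end
  -- `b` if the single deleted vertex lies between `a` and `y`.
  · have hvs : v ∈ s := hmem.2 ⟨.inl rfl, hvX⟩
    refine ⟨v, hvs, fun y hy => ?_⟩
    rcases (hmem.1 hy).1 with rfl | hyp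
    · exact SimpleGraph.Reachable.refl _
    by_cases hx : ∀ z ∈ (p.takeUntil y hyp).support, z ∉ X
    · refine lift _ _ (.cons ha (p.takeUntil y hyp)) fun z hz => ?_
      rcases List.mem_cons.1 hz with rfl | hz
      · exact hvs
      · exact hmem.2 ⟨.inr (p.support_takeUntil_subset_support hyp hz), hx z hz⟩
    · push Not at hx
      obtain ⟨x, hx, hxX⟩ := hx
      refine lift _ _ (.cons hb (p.dropUntil y hyp).reverse) fun z hz => ?_
      rcases List.mem_cons.1 hz with rfl | hz
      · exact hvs
      · rw [SimpleGraph.Walk.support_reverse, List.mem_reverse] at hz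
        refine hmem.2 ⟨.inr (p.support_dropUntil_subset_support hyp hz), fun hzX => ?_⟩
        obtain rfl := hone hxX hzX
        have hxy : x ≠ y := fun h => (hmem.1 hy).2 (h ▸ hxX)
        exact SimpleGraph.Walk.IsPath.ne_of_mem_support_of_append
          (by rwa [p.take_spec hyp]) hxy hx hz rfl

theorem exists_isBlock_of_isTwoConnectedOn [Finite V] {C : Finset V} (h : IsTwoConnectedOn G C) :
    ∃ B, IsBlock G B ∧ C ⊆ B := by
  obtain ⟨B, hCB, hB⟩ := Finite.exists_le_maximal h
  exact ⟨B, hB, hCB⟩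

open scoped Classical in
theorem isTwoConnectedOn_of_isClique {C : Finset V} (h : G.IsClique (↑C : Set V)) :
    IsTwoConnectedOn G C := by
  intro X _ x y
  by_cases hxy : x = y
  · rw [hxy]
  · refine SimpleGraph.Adj.reachable ?_
    exact h (Finset.mem_sdiff.1 x.2).1 (Finset.mem_sdiff.1 y.2).1 fun h => hxy (Subtype.ext h)

theorem IsBlock.eq_of_subset {B C : Finset V} (hB : IsBlock G B) (hC : IsTwoConnectedOn G C)
    (h : B ⊆ C) : B = C :=
  (hB.eq_of_ge hC h).symm

theorem exists_isBlock_of_adj [Finite V] {a b : V} (h : G.Adj a b) :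
    ∃ B, IsBlock G B ∧ a ∈ B ∧ b ∈ B := by
  classical
  have hc : G.IsClique (↑({a, b} : Finset V) : Set V) := by
    rw [Finset.coe_pair, SimpleGraph.isClique_pair]
    exact fun _ => h
  obtain ⟨B, hB, hs⟩ := exists_isBlock_of_isTwoConnectedOn (isTwoConnectedOn_of_isClique hc)
  exact ⟨B, hB, hs (by simp), hs (by simp)⟩

/-- Two neighbours of `v` that are joined avoiding `v` lie in a common block with `v`. -/
theorem exists_isBlock_of_joinedAvoiding [Finite V] {v a b : V} (ha : G.Adj v a) (hb : G.Adj v b)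
    (h : JoinedAvoiding G v a b) : ∃ B, IsBlock G B ∧ v ∈ B ∧ a ∈ B ∧ b ∈ B := by
  classical
  obtain ⟨p, hp⟩ := h
  -- Bypassing repetitions turns the walk into a path that still avoids `v`.
  obtain ⟨B, hB, hs⟩ := exists_isBlock_of_isTwoConnectedOn
    (isTwoConnectedOn_insert_support p.bypass p.bypass_isPath
      (fun h => hp (p.support_bypass_subset_support h)) ha hb)
  exact ⟨B, hB, hs (by simp), hs (by simp), hs (by simp)⟩

section

variable [Finite V] (hG : IsBlockGraph G)
include hG

/-- Two blocks that share two vertices are equal. -/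
theorem IsBlock.eq_of_mem_of_mem {B B' : Finset V} (hB : IsBlock G B) (hB' : IsBlock G B')
    {u v : V} (huv : u ≠ v) (hu : u ∈ B) (hv : v ∈ B) (hu' : u ∈ B') (hv' : v ∈ B') :
    B = B' := by
  classical
  have hc := hG B hB
  have hc' := hG B' hB'
  -- In the main case `x` and `y` are neighbours of `v` joined through `u`, so they share a block,
  -- which is a clique. Then `B ∪ B'` is a clique and maximality makes both blocks equal to it.
  have hadj : ∀ x ∈ B, ∀ y ∈ B', x ≠ y → G.Adj x y := by
    intro x hx y hy hxy
    by_cases hxu : x = u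
    · subst hxu; exact hc' hu' hy hxy
    by_cases hyu : y = u
    · subst hyu; exact hc hx hu hxy
    by_cases hxv : x = v
    · subst hxv; exact hc' hv' hy hxy
    by_cases hyv : y = v
    · subst hyv; exact hc hx hv hxy
    obtain ⟨D, hD, -, h1, h2⟩ := exists_isBlock_of_joinedAvoiding (v := v)
      (hc hv hx (Ne.symm hxv)) (hc' hv' hy (Ne.symm hyv))
      ((JoinedAvoiding.of_adj (hc hx hu hxu) (Ne.symm hxv) huv.symm).trans
        (JoinedAvoiding.of_adj (hc' hu' hy (Ne.symm hyu)) huv.symm (Ne.symm hyv)))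
    exact hG D hD h1 h2 hxy
  have hU : G.IsClique (↑(B ∪ B') : Set V) := by
    intro x hx y hy hxy
    rcases Finset.mem_union.1 hx with hx | hx <;> rcases Finset.mem_union.1 hy with hy | hy
    · exact hc hx hy hxy
    · exact hadj x hx y hy hxy
    · exact (hadj y hy x hx hxy.symm).symm
    · exact hc' hx hy hxy
  have hU2 := isTwoConnectedOn_of_isClique hU
  rw [hB.eq_of_subset hU2 Finset.subset_union_left]
  exact (hB'.eq_of_subset hU2 Finset.subset_union_right).symm

/-- Distinct blocks with the common vertex `v` are separated by `v`. -/
theorem not_joinedAvoiding_of_ne {B B' : Finset V} (hB : IsBlock G B) (hB' : IsBlock G B')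
    (hne : B ≠ B') {v a b : V} (hv : v ∈ B) (hv' : v ∈ B') (ha : a ∈ B) (hb : b ∈ B')
    (hav : a ≠ v) (hbv : b ≠ v) : ¬ JoinedAvoiding G v a b := by
  intro h
  obtain ⟨D, hD, h1, h2, h3⟩ := exists_isBlock_of_joinedAvoiding
    (hG B hB hv ha hav.symm) (hG B' hB' hv' hb hbv.symm) h
  exact hne ((hB.eq_of_mem_of_mem hG hD hav ha hv h2 h1).trans
    (hB'.eq_of_mem_of_mem hG hD hbv hb hv' h3 h1).symm)

theorem not_adj_of_ne_blocks {B B' : Finset V} (hB : IsBlock G B) (hB' : IsBlock G B')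
    (hne : B ≠ B') {v a b : V} (hv : v ∈ B) (hv' : v ∈ B') (ha : a ∈ B) (hb : b ∈ B')
    (hav : a ≠ v) (hbv : b ≠ v) : ¬ G.Adj a b := fun h =>
  not_joinedAvoiding_of_ne hG hB hB' hne hv hv' ha hb hav hbv
    (JoinedAvoiding.of_adj h hav.symm hbv.symm)

/-- Three blocks through `v` with further vertices in `A` yield a claw with centre `v`. -/
theorem clawAt_of_blocks {A : Finset V} {v : V} {B : Fin 3 → Finset V} (hB : ∀ i, IsBlock G (B i))
    (hinj : Function.Injective B) (hv : ∀ i, v ∈ B i) {a : Fin 3 → V} (ha : ∀ i, a i ∈ B i)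
    (hav : ∀ i, a i ≠ v) (haA : ∀ i, a i ∈ A) : ClawAt G A v := by
  refine ⟨a, fun i j hij => ?_, fun i => ⟨haA i, hG _ (hB i) (hv i) (ha i) (hav i).symm⟩,
    fun i j hij => ?_⟩
  · refine hinj ((hB i).eq_of_mem_of_mem hG (hB j) (hav i) (ha i) (hv i) ?_ (hv j))
    rw [hij]; exact ha j
  · have hne : i ≠ j := by rintro rfl; exact hij.ne rfl
    exact not_adj_of_ne_blocks hG (hB i) (hB j) (hinj.ne hne) (hv i) (hv j) (ha i) (ha j)
      (hav i) (hav j) hij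

end

/-! ### Cutpoints -/

/-- A connected graph has one component, so `v` is a cutpoint as soon as `G - v` has two. With
`IsCutpoint.exists_not_joinedAvoiding` this replaces counting components by walks avoiding `v`. -/
theorem isCutpoint_of_not_joinedAvoiding [Finite V] (hconn : G.Connected) {v a b : V} (ha : a ≠ v)
    (hb : b ≠ v) (h : ¬ JoinedAvoiding G v a b) : IsCutpoint G v := by
  have h1 : Nat.card G.ConnectedComponent = 1 := by
    have := hconn.nonempty
    have := hconn.preconnected.subsingleton_connectedComponent
    exact Nat.card_unique
  rw [IsCutpoint, h1, Finite.one_lt_card_iff_nontrivial]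
  refine ⟨SimpleGraph.connectedComponentMk _ ⟨a, ha⟩, SimpleGraph.connectedComponentMk _ ⟨b, hb⟩,
    fun he => h ?_⟩
  obtain ⟨p⟩ := SimpleGraph.ConnectedComponent.exact he
  have hne : ∀ x : ({v}ᶜ : Set V), v ≠ x.1 := fun x h => x.2 h.symm
  have key : ∀ {x y : ({v}ᶜ : Set V)}, (G.induce ({v}ᶜ : Set V)).Walk x y →
      JoinedAvoiding G v x y := by
    intro x y p
    induction p with
    | nil => exact JoinedAvoiding.refl (hne _)
    | cons h _ ih => exact (JoinedAvoiding.of_adj (G := G) h (hne _) (hne _)).trans ih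
  exact key p

theorem IsCutpoint.exists_not_joinedAvoiding [Finite V] (hconn : G.Connected) {v : V}
    (h : IsCutpoint G v) : ∃ a b, a ≠ v ∧ b ≠ v ∧ ¬ JoinedAvoiding G v a b := by
  by_contra! hcon
  have hpre : (G.induce ({v}ᶜ : Set V)).Preconnected := by
    intro x y
    obtain ⟨p, hp⟩ := hcon x.1 y.1 x.2 y.2
    exact ⟨p.induce _ fun z hz (hzv : z = v) => hp (hzv ▸ hz)⟩
  have h2 := hpre.subsingleton_connectedComponent
  have h3 : Nat.card (G.induce ({v}ᶜ : Set V)).ConnectedComponent ≤ 1 :=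
    Finite.card_le_one_iff_subsingleton.2 h2
  have h4 : 0 < Nat.card G.ConnectedComponent := by
    have := hconn.nonempty
    exact Nat.card_pos
  unfold IsCutpoint at h
  omega

/-- A geodesic between nonadjacent vertices contains consecutive `x`, `v`, `y` with `x` and `y`
nonadjacent. If `x` and `y` were joined avoiding `v` they would share a block, hence be adjacent. -/
theorem exists_isCutpoint [Finite V] (hG : IsBlockGraph G) (hconn : G.Connected) (hne : G ≠ ⊤) :
    ∃ r, IsCutpoint G r := by
  obtain ⟨a, b, hab, hnadj⟩ : ∃ a b, a ≠ b ∧ ¬ G.Adj a b := by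
    by_contra! h
    exact hne (by ext a b; exact ⟨fun h => h.ne, h a b⟩)
  obtain ⟨p, hp⟩ := hconn.exists_walk_length_eq_dist a b
  obtain ⟨x, v, y, hxv, hvy, hxy, hne⟩ := SimpleGraph.Walk.exists_adj_adj_not_adj_ne hp
    (hconn.one_lt_dist_of_ne_of_not_adj hab hnadj)
  refine ⟨v, isCutpoint_of_not_joinedAvoiding hconn hxv.ne hvy.ne' fun h => ?_⟩
  obtain ⟨B, hB, -, hx, hy⟩ := exists_isBlock_of_joinedAvoiding hxv.symm hvy h
  exact hxy (hG B hB hx hy hne)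

/-- A block has at least two vertices unless `G` is a single vertex. -/
theorem IsBlock.exists_ne [Finite V] [Nontrivial V] (hconn : G.Connected) {B : Finset V}
    (hB : IsBlock G B) (v : V) :
    ∃ a ∈ B, a ≠ v := by
  classical
  by_contra! h
  obtain ⟨x, hx⟩ := hconn.preconnected.exists_adj_of_nontrivial v
  obtain ⟨D, hD, hv, hxD⟩ := exists_isBlock_of_adj hx
  have hBD : B ⊆ D := fun a ha => h a ha ▸ hv
  have := hB.eq_of_subset hD.1 hBD
  exact hx.ne' (h x (this ▸ hxD))

/-- After its first step, a path from `v` never returns to `v`. Thus each component of `G - v` is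
represented by a neighbour of `v`. -/
theorem exists_adj_joinedAvoiding (hconn : G.Connected) {u v : V} (h : u ≠ v) :
    ∃ a, G.Adj v a ∧ JoinedAvoiding G v a u := by
  obtain ⟨p, hp⟩ := hconn.exists_isPath v u
  cases p with
  | nil => exact absurd rfl h
  | cons h' q =>
    rw [SimpleGraph.Walk.cons_isPath_iff] at hp
    exact ⟨_, h', q, hp.2⟩

section

variable [Finite V] (hG : IsBlockGraph G) (hconn : G.Connected)
include hG hconn

/-- With `IsCutpoint.exists_isBlock_ne`, this characterises the cutpoints as the vertices lying in
at least two blocks. -/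
theorem isCutpoint_of_mem_of_mem [Nontrivial V] {B B' : Finset V} (hB : IsBlock G B)
    (hB' : IsBlock G B') (hne : B ≠ B') {v : V} (hv : v ∈ B) (hv' : v ∈ B') :
    IsCutpoint G v := by
  obtain ⟨a, ha, hav⟩ := hB.exists_ne hconn v
  obtain ⟨b, hb, hbv⟩ := hB'.exists_ne hconn v
  exact isCutpoint_of_not_joinedAvoiding hconn hav hbv
    (not_joinedAvoiding_of_ne hG hB hB' hne hv hv' ha hb hav hbv)

/-- A cutpoint lies in a block other than any given one. -/
theorem IsCutpoint.exists_isBlock_ne {v : V} (h : IsCutpoint G v) (B : Finset V)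
    (hB : IsBlock G B) : ∃ B', IsBlock G B' ∧ v ∈ B' ∧ B' ≠ B := by
  by_contra! hcon
  obtain ⟨a, b, ha, hb, hab⟩ := h.exists_not_joinedAvoiding hconn
  obtain ⟨a', h1, h2⟩ := exists_adj_joinedAvoiding hconn ha
  obtain ⟨b', h3, h4⟩ := exists_adj_joinedAvoiding hconn hb
  -- If `B` were the only block through `v`, all neighbours of `v` would lie in one clique and stay
  -- joined without `v`.
  have key : ∀ x, G.Adj v x → x ∈ B := by
    intro x hx
    obtain ⟨D, hD, hv, hxD⟩ := exists_isBlock_of_adj hx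
    exact hcon D hD hv ▸ hxD
  refine hab (h2.symm.trans (JoinedAvoiding.trans ?_ h4))
  by_cases hne : a' = b'
  · rw [hne]; exact JoinedAvoiding.refl h3.ne
  · exact JoinedAvoiding.of_adj (hG B hB (key _ h1) (key _ h3) hne) h1.ne h3.ne

end

/-! ### The block-cutpoint-tree -/

section

variable (hconn : G.Connected)
include hconn

theorem exists_adj_dist_eq {r u : V} (h : 0 < G.dist r u) :
    ∃ p, G.Adj p u ∧ G.dist r u = G.dist r p + 1 := by
  obtain ⟨q, hq⟩ := hconn.exists_walk_length_eq_dist u r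
  cases q with
  | nil => simp at h
  | cons h' q =>
    rename_i p
    refine ⟨p, h'.symm, ?_⟩
    have h1 := SimpleGraph.dist_le q
    rw [SimpleGraph.Walk.length_cons, SimpleGraph.dist_comm] at hq
    rw [SimpleGraph.dist_comm] at h1
    have h2 := h'.diff_dist_adj (u := r)
    omega

/-- A vertex other than `u` and no farther from `r` than `u` is joined to `r` avoiding `u`. -/
theorem joinedAvoiding_of_dist_le {r u u' : V} (hne : u ≠ u') (h : G.dist r u' ≤ G.dist r u) :
    JoinedAvoiding G u u' r := by
  induction hn : G.dist r u' generalizing u' with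
  | zero =>
    obtain rfl := hconn.dist_eq_zero_iff.1 hn
    exact JoinedAvoiding.refl hne
  | succ n ih =>
    obtain ⟨p, hp, hd⟩ := exists_adj_dist_eq hconn (r := r) (u := u') (by omega)
    have hup : u ≠ p := by rintro rfl; omega
    exact (JoinedAvoiding.of_adj hp.symm hne hup).trans (ih hup (by omega) (by omega))

end

/-- The least distance from `r` to a vertex of `B`. -/
noncomputable def blockDist (G : SimpleGraph V) (r : V) (B : Finset V) : ℕ :=
  sInf (G.dist r '' (↑B : Set V))

theorem blockDist_le {r v : V} {B : Finset V} (hv : v ∈ B) : blockDist G r B ≤ G.dist r v :=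
  Nat.sInf_le ⟨v, hv, rfl⟩

theorem exists_dist_eq_blockDist (r : V) {B : Finset V} (hB : B.Nonempty) :
    ∃ g ∈ B, G.dist r g = blockDist G r B :=
  Nat.sInf_mem (hB.to_set.image (G.dist r))

/-- In a clique every vertex is adjacent to a nearest one, so only two distances from `r` occur. -/
theorem dist_eq_blockDist_or {r v : V} {B : Finset V} (hc : G.IsClique (↑B : Set V)) (hv : v ∈ B) :
    G.dist r v = blockDist G r B ∨ G.dist r v = blockDist G r B + 1 := by
  obtain ⟨g, hg, hgd⟩ := exists_dist_eq_blockDist (G := G) r ⟨v, hv⟩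
  have h1 := blockDist_le (G := G) (r := r) hv
  by_cases h : v = g
  · subst h; exact .inl hgd
  · have := (hc hg hv (Ne.symm h)).diff_dist_adj (u := r)
    omega

/-- The distance from the node of the cutpoint `r` in the block-cutpoint-tree. -/
noncomputable def bcDist (G : SimpleGraph V) (r : V) : BCNode G → ℕ
  | .cut v _ => 2 * G.dist r v
  | .block B _ => 2 * blockDist G r B + 1

/-- The potential is `bcDist`. The parent of a block is its unique vertex nearest to `r`; the parent
of a cutpoint `v ≠ r` is the block containing an edge from `v` towards `r`. -/
theorem isRootedTree_blockCutpointGraph [Finite V] (hG : IsBlockGraph G) (hconn : G.Connected)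
    [Nontrivial V] {r : V} (hr : IsCutpoint G r) :
    IsRootedTree (blockCutpointGraph G) (BCNode.cut r hr) := by
  -- Two nearest vertices `u`, `u'` cannot coexist: a predecessor `p` of `u` would be joined to `u'`
  -- through `r` avoiding `u`, which puts `p` into `B`, closer to `r` than the minimum.
  have hgate : ∀ {B : Finset V}, IsBlock G B → ∀ {u u' : V}, u ∈ B → u' ∈ B →
      G.dist r u = blockDist G r B → G.dist r u' = blockDist G r B → u = u' := by
    intro B hB u u' hu hu' hd hd'
    by_contra hne
    rcases Nat.eq_zero_or_pos (G.dist r u) with h0 | hpos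
    · rw [hd] at h0
      rw [h0] at hd hd'
      exact hne ((hconn.dist_eq_zero_iff.1 hd).symm.trans (hconn.dist_eq_zero_iff.1 hd'))
    · obtain ⟨p, hp, hpd⟩ := exists_adj_dist_eq hconn hpos
      have h1 := joinedAvoiding_of_dist_le hconn hp.ne' (r := r) (by omega)
      have h2 := joinedAvoiding_of_dist_le hconn hne (r := r) (by omega)
      obtain ⟨D, hD, huD, hpD, huD'⟩ := exists_isBlock_of_joinedAvoiding hp.symm
        (hG B hB hu hu' hne) (h1.trans h2.symm)
      obtain rfl := hB.eq_of_mem_of_mem hG hD hne hu hu' huD huD'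
      have := blockDist_le (G := G) (r := r) hpD
      omega
  refine IsRootedTree.of_potential (φ := bcDist G r) ?_ ?_ ?_ ?_
  · rintro (⟨v, hv⟩ | ⟨B, hB⟩)
    · simp only [bcDist, BCNode.cut.injEq]
      rw [Nat.mul_eq_zero, hconn.dist_eq_zero_iff]
      simp [eq_comm]
    · simp [bcDist]
  · rintro (⟨v, hv⟩ | ⟨B, hB⟩) (⟨v', hv'⟩ | ⟨B', hB'⟩) h
    · exact h.elim
    · have := dist_eq_blockDist_or (r := r) (hG B' hB') h
      simp only [bcDist]
      omega
    · have := dist_eq_blockDist_or (r := r) (hG B hB) h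
      simp only [bcDist]
      omega
    · exact h.elim
  · rintro (⟨v, hv⟩ | ⟨B, hB⟩) hpos
    · obtain ⟨p, hp, hpd⟩ := exists_adj_dist_eq hconn (r := r) (u := v)
        (by simp [bcDist] at hpos; omega)
      obtain ⟨B, hB, hpB, hvB⟩ := exists_isBlock_of_adj hp
      refine ⟨.block B hB, hvB, ?_⟩
      have h1 := blockDist_le (G := G) (r := r) hpB
      have h2 := dist_eq_blockDist_or (r := r) (hG B hB) hvB
      simp only [bcDist]
      omega
    · obtain ⟨a, ha, -⟩ := hB.exists_ne hconn r
      obtain ⟨g, hg, hgd⟩ := exists_dist_eq_blockDist (G := G) r ⟨a, ha⟩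
      -- Either `g = r`, or the edge from `g` towards `r` lies in a second block, since its other
      -- end is closer to `r` than all of `B`.
      have hcut : IsCutpoint G g := by
        rcases Nat.eq_zero_or_pos (G.dist r g) with h0 | hpos
        · obtain rfl := hconn.dist_eq_zero_iff.1 h0
          exact hr
        · obtain ⟨p, hp, hpd⟩ := exists_adj_dist_eq hconn hpos
          obtain ⟨B', hB', hpB, hgB⟩ := exists_isBlock_of_adj hp
          refine isCutpoint_of_mem_of_mem hG hconn hB hB' ?_ hg hgB
          rintro rfl
          have := blockDist_le (G := G) (r := r) hpB
          omega
      exact ⟨.cut g hcut, hg, by simp only [bcDist]; omega⟩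
  · rintro (⟨v, hv⟩ | ⟨B, hB⟩) (⟨v', hv'⟩ | ⟨B', hB'⟩) (⟨x, hx⟩ | ⟨D, hD⟩) h h' h1 h2
    all_goals first | exact h.elim | exact h'.elim | skip
    · simp only [bcDist] at h1 h2
      congr 1
      exact hgate hD h h' (by omega) (by omega)
    · simp only [bcDist] at h1 h2
      congr 1
      -- Two parent blocks of `x` would have nearest vertices joined through `r` avoiding `x`,
      -- although `x` separates them.
      by_contra hne
      obtain ⟨g, hg, hgd⟩ := exists_dist_eq_blockDist (G := G) r ⟨x, h⟩
      obtain ⟨g', hg', hgd'⟩ := exists_dist_eq_blockDist (G := G) r ⟨x, h'⟩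
      have hgx : g ≠ x := by rintro rfl; omega
      have hgx' : g' ≠ x := by rintro rfl; omega
      exact not_joinedAvoiding_of_ne hG hB hB' hne h h' hg hg' hgx hgx'
        ((joinedAvoiding_of_dist_le hconn hgx.symm (r := r) (by omega)).trans
          (joinedAvoiding_of_dist_le hconn hgx'.symm (r := r) (by omega)).symm)

end Blocks

/-! ### The vertex sets attached to the nodes -/

section Below

variable {V : Type u} {G : SimpleGraph V} {ρ : BCNode G}

theorem IsChild.exists_block {v : V} {hv : IsCutpoint G v} {y : BCNode G}
    (h : IsChild (blockCutpointGraph G) ρ (.cut v hv) y) :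
    ∃ B hB, y = .block B hB ∧ v ∈ B := by
  rcases y with ⟨u, hu⟩ | ⟨B, hB⟩
  · exact h.1.elim
  · exact ⟨B, hB, rfl, h.1⟩

theorem IsChild.exists_cut {B : Finset V} {hB : IsBlock G B} {y : BCNode G}
    (h : IsChild (blockCutpointGraph G) ρ (.block B hB) y) :
    ∃ v hv, y = .cut v hv ∧ v ∈ B := by
  rcases y with ⟨u, hu⟩ | ⟨B', hB'⟩
  · exact ⟨u, hu, rfl, h.1⟩
  · exact h.1.elim

theorem IsChild.exists_cut_parent {B : Finset V} {hB : IsBlock G B} {y : BCNode G}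
    (h : IsChild (blockCutpointGraph G) ρ y (.block B hB)) :
    ∃ v hv, y = .cut v hv ∧ v ∈ B := by
  rcases y with ⟨u, hu⟩ | ⟨B', hB'⟩
  · exact ⟨u, hu, rfl, h.1⟩
  · exact h.1.elim

theorem IsChild.exists_block_parent {v : V} {hv : IsCutpoint G v} {y : BCNode G}
    (h : IsChild (blockCutpointGraph G) ρ y (.cut v hv)) :
    ∃ B hB, y = .block B hB ∧ v ∈ B := by
  rcases y with ⟨u, hu⟩ | ⟨B, hB⟩
  · exact h.1.elim
  · exact ⟨B, hB, rfl, h.1⟩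

/-- A cutpoint of `B` is a tree neighbour of the node of `B`, hence its child or its only parent. -/
theorem eq_parent_or (hT : IsRootedTree (blockCutpointGraph G) ρ) {p : V}
    {hp : IsCutpoint G p} {B : Finset V} {hB : IsBlock G B}
    (hx : IsChild (blockCutpointGraph G) ρ (.cut p hp) (.block B hB)) {u : V} (hu : u ∈ B) :
    u = p ∨ ¬ IsCutpoint G u ∨
      ∃ hc : IsCutpoint G u, IsChild (blockCutpointGraph G) ρ (.block B hB) (.cut u hc) := by
  by_cases hc : IsCutpoint G u
  · rcases hT.adj (.block B hB) (.cut u hc) hu with h | h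
    · exact .inr (.inr ⟨hc, h⟩)
    · cases hT.unique _ _ _ h hx; exact .inl rfl
  · exact .inr (.inl hc)

variable [Fintype V]

theorem mem_below {x : BCNode G} {u : V} : u ∈ below G ρ x ↔
    ∃ (B : Finset V) (h : IsBlock G B), BCNode.block B h ∈ subtree (blockCutpointGraph G) ρ x ∧
      u ∈ B := by
  simp [below, vertsOf]

theorem mem_below_of_mem {B : Finset V} {hB : IsBlock G B} {u : V} (hu : u ∈ B) :
    u ∈ below G ρ (.block B hB) :=
  mem_below.2 ⟨B, hB, mem_subtree_self _, hu⟩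

theorem below_subset {x y : BCNode G} (h : IsChild (blockCutpointGraph G) ρ x y) :
    below G ρ y ⊆ below G ρ x := by
  intro u hu
  obtain ⟨B, hB, h1, h2⟩ := mem_below.1 hu
  exact mem_below.2 ⟨B, hB, subtree_trans h.mem_subtree h1, h2⟩

theorem mem_below_cut {v : V} {hv : IsCutpoint G v} {u : V} : u ∈ below G ρ (.cut v hv) ↔
    ∃ y, IsChild (blockCutpointGraph G) ρ (.cut v hv) y ∧ u ∈ below G ρ y := by
  constructor
  · intro hu
    obtain ⟨B, hB, h1, h2⟩ := mem_below.1 hu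
    rcases mem_subtree_iff.1 h1 with h | ⟨y, h3, h4⟩
    · cases h
    · exact ⟨y, h3, mem_below.2 ⟨B, hB, h4, h2⟩⟩
  · rintro ⟨y, h1, h2⟩
    exact below_subset h1 h2

theorem mem_below_block {B : Finset V} {hB : IsBlock G B} {u : V} :
    u ∈ below G ρ (.block B hB) ↔
    u ∈ B ∨ ∃ y, IsChild (blockCutpointGraph G) ρ (.block B hB) y ∧ u ∈ below G ρ y := by
  constructor
  · intro hu
    obtain ⟨B', hB', h1, h2⟩ := mem_below.1 hu
    rcases mem_subtree_iff.1 h1 with h | ⟨y, h3, h4⟩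
    · cases h
      exact .inl h2
    · exact .inr ⟨y, h3, mem_below.2 ⟨B', hB', h4, h2⟩⟩
  · rintro (h | ⟨y, h1, h2⟩)
    · exact mem_below_of_mem h
    · exact below_subset h1 h2

variable [Nontrivial V]

theorem exists_isBlock_mem (hconn : G.Connected) (u : V) : ∃ B, IsBlock G B ∧ u ∈ B := by
  obtain ⟨x, hx⟩ := hconn.preconnected.exists_adj_of_nontrivial u
  obtain ⟨D, hD, hv, -⟩ := exists_isBlock_of_adj hx
  exact ⟨D, hD, hv⟩

theorem below_root (hconn : G.Connected) (hT : IsRootedTree (blockCutpointGraph G) ρ) :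
    below G ρ ρ = Finset.univ := by
  refine Finset.eq_univ_of_forall fun u => ?_
  obtain ⟨B, hB, hu⟩ := exists_isBlock_mem hconn u
  exact mem_below.2 ⟨B, hB, hT.reach _, hu⟩

variable (hG : IsBlockGraph G) (hconn : G.Connected)
  (hT : IsRootedTree (blockCutpointGraph G) ρ)

include hG hconn hT

/-- A cutpoint lies in two blocks, and at most one of them is its parent. -/
theorem exists_isChild_cut {v : V} (hv : IsCutpoint G v) :
    ∃ y, IsChild (blockCutpointGraph G) ρ (.cut v hv) y := by
  obtain ⟨B, hB, hvB⟩ := exists_isBlock_mem hconn v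
  obtain ⟨B', hB', hvB', hne⟩ := hv.exists_isBlock_ne hG hconn B hB
  rcases hT.adj (.cut v hv) (.block B hB) hvB with h | h
  · exact ⟨_, h⟩
  rcases hT.adj (.cut v hv) (.block B' hB') hvB' with h' | h'
  · exact ⟨_, h'⟩
  · have := hT.unique _ _ _ h h'
    cases this
    exact absurd rfl hne

theorem mem_below_cut_self {v : V} (hv : IsCutpoint G v) : v ∈ below G ρ (.cut v hv) := by
  obtain ⟨y, hy⟩ := exists_isChild_cut hG hconn hT hv
  obtain ⟨B, hB, rfl, hvB⟩ := hy.exists_block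
  exact mem_below_cut.2 ⟨_, hy, mem_below_of_mem hvB⟩

/-- The blocks through a vertex of `G_x` lie in `T_x`, unless that vertex belongs to the node `x`
or to its parent. -/
theorem block_mem_subtree_or {x : BCNode G} {u : V} {B : Finset V} (hu : u ∈ below G ρ x)
    (hB : IsBlock G B) (huB : u ∈ B) :
    BCNode.block B hB ∈ subtree (blockCutpointGraph G) ρ x ∨
      ∃ hu : IsCutpoint G u, x = .cut u hu ∨ IsChild (blockCutpointGraph G) ρ (.cut u hu) x := by
  obtain ⟨B', hB', h1, h2⟩ := mem_below.1 hu
  by_cases hne : B' = B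
  · subst hne; exact .inl h1
  have hcut := isCutpoint_of_mem_of_mem hG hconn hB' hB hne h2 huB
  -- Follow the steps `B'`, `u`, `B` in the tree: a step can leave `T_x` only from `x` to its
  -- parent.
  rcases hT.mem_subtree_of_adj (y := .block B' hB') (z := .cut u hcut) h2 h1 with h | h
  · rcases hT.mem_subtree_of_adj (y := .cut u hcut) (z := .block B hB) huB h with h' | h'
    · exact .inl h'
    · exact .inr ⟨hcut, .inl h'.1.symm⟩
  · exact .inr ⟨hcut, .inr h.2⟩

/-- The subgraphs attached to two children of a node share at most the vertex of that node. -/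
theorem exists_eq_cut_of_mem_below {q x x' : BCNode G} {u : V}
    (hx : IsChild (blockCutpointGraph G) ρ q x) (hx' : IsChild (blockCutpointGraph G) ρ q x')
    (hne : x ≠ x') (hu : u ∈ below G ρ x) (hu' : u ∈ below G ρ x') :
    ∃ hu : IsCutpoint G u, q = .cut u hu := by
  obtain ⟨B, hB, h1, h2⟩ := mem_below.1 hu
  obtain ⟨B', hB', h1', h2'⟩ := mem_below.1 hu'
  rcases block_mem_subtree_or hG hconn hT hu hB' h2' with h | ⟨hc, h | h⟩
  · exact absurd h1' (hT.disjoint_subtree hx hx' hne h)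
  · rcases block_mem_subtree_or hG hconn hT hu' hB h2 with h' | ⟨hc', h' | h'⟩
    · exact absurd h' (hT.disjoint_subtree hx hx' hne h1)
    · exact absurd (h.trans h'.symm) hne
    · exact ⟨hc', hT.unique _ _ _ hx' h'⟩
  · exact ⟨hc, hT.unique _ _ _ hx h⟩

/-- The node of the parent block lies outside `T_v`, so the block can meet `G_v` only at the
attaching vertex. -/
theorem eq_of_mem_below_cut {B : Finset V} {hB : IsBlock G B} {v : V} {hv : IsCutpoint G v}
    (h : IsChild (blockCutpointGraph G) ρ (.block B hB) (.cut v hv)) {u : V}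
    (hu : u ∈ below G ρ (.cut v hv)) (huB : u ∈ B) : u = v := by
  rcases block_mem_subtree_or hG hconn hT hu hB huB with h' | ⟨hc, h' | h'⟩
  · exact absurd h' h.notMem_subtree
  · cases h'; rfl
  · exact h'.1.elim

/-- `G_v` contains the neighbours of its vertices other than `v`. -/
theorem mem_below_cut_of_adj {v : V} {hv : IsCutpoint G v} {u z : V}
    (hu : u ∈ below G ρ (.cut v hv)) (huv : u ≠ v) (h : G.Adj u z) :
    z ∈ below G ρ (.cut v hv) := by
  obtain ⟨B, hB, huB, hzB⟩ := exists_isBlock_of_adj h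
  rcases block_mem_subtree_or hG hconn hT hu hB huB with h' | ⟨hc, h' | h'⟩
  · exact mem_below.2 ⟨B, hB, h', hzB⟩
  · cases h'; exact absurd rfl huv
  · exact h'.1.elim

/-- `G_b` contains the neighbours of its vertices other than the parent of `b`. -/
theorem mem_below_block_of_adj {v : V} {hv : IsCutpoint G v} {x : BCNode G} {u z : V}
    (hx : IsChild (blockCutpointGraph G) ρ (.cut v hv) x)
    (hu : u ∈ below G ρ x) (huv : u ≠ v) (h : G.Adj u z) : z ∈ below G ρ x := by
  obtain ⟨B, hB, huB, hzB⟩ := exists_isBlock_of_adj h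
  rcases block_mem_subtree_or hG hconn hT hu hB huB with h' | ⟨hc, h' | h'⟩
  · exact mem_below.2 ⟨B, hB, h', hzB⟩
  · rw [h'] at hx; exact hx.1.elim
  · cases hT.unique _ _ _ h' hx; exact absurd rfl huv

/-- The neighbours in `G_b` of the parent of `b` lie in `b`. -/
theorem mem_block_of_adj_parent {v : V} {hv : IsCutpoint G v} {B : Finset V} {hB : IsBlock G B}
    {z : V} (hx : IsChild (blockCutpointGraph G) ρ (.cut v hv) (.block B hB))
    (hz : z ∈ below G ρ (.block B hB)) (h : G.Adj v z) : z ∈ B := by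
  obtain ⟨D, hD, hvD, hzD⟩ := exists_isBlock_of_adj h
  rcases block_mem_subtree_or hG hconn hT hz hD hzD with h' | ⟨hc, h' | h'⟩
  · rcases hT.mem_subtree_of_adj (y := .block D hD) (z := .cut v hv) hvD h' with h2 | h2
    · exact absurd h2 hx.notMem_subtree
    · cases h2.1; exact hzD
  · cases h'
  · cases hT.unique _ _ _ h' hx; exact absurd rfl h.ne

/-- The neighbours in `G_b` of a vertex `u` of `b` lie in `b` or in `G_u`. -/
theorem mem_block_or_of_adj {B : Finset V} {hB : IsBlock G B} {u z : V} (hu : u ∈ B)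
    (hz : z ∈ below G ρ (.block B hB)) (h : G.Adj u z) :
    z ∈ B ∨ ∃ hu : IsCutpoint G u, IsChild (blockCutpointGraph G) ρ (.block B hB) (.cut u hu) ∧
      z ∈ below G ρ (.cut u hu) := by
  rcases mem_below_block.1 hz with hz | ⟨y, hy, hzy⟩
  · exact .inl hz
  · obtain ⟨v, hv, rfl, hvB⟩ := hy.exists_cut
    by_cases hzv : z = v
    · subst hzv; exact .inl hvB
    · have hu' := mem_below_cut_of_adj hG hconn hT hzy hzv h.symm
      obtain rfl := eq_of_mem_below_cut hG hconn hT hy hu' hu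
      exact .inr ⟨hv, hy, hzy⟩

end Below

/-! ### The minima in the recurrences -/

section Minima

variable {ι : Type*} {C : Finset ι} {g h : ι → ℕ}

open scoped Classical

/-- This form, one sum over all children with a choice set `K`, allows choices to be compared term
by term. -/
theorem sum_add_sum_sdiff {K : Finset ι} (hK : K ⊆ C) :
    ∑ b ∈ K, g b + ∑ b ∈ C \ K, h b = ∑ b ∈ C, if b ∈ K then g b else h b := by
  rw [Finset.sum_ite, Finset.filter_mem_eq_inter, Finset.inter_eq_right.2 hK,
    Finset.filter_notMem_eq_sdiff]

theorem sum_ite_le_of_subset (hgh : ∀ b ∈ C, g b ≤ h b) {K K' : Finset ι} (hKK : K ⊆ K') :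
    (∑ b ∈ C, if b ∈ K' then g b else h b) ≤ ∑ b ∈ C, if b ∈ K then g b else h b := by
  refine Finset.sum_le_sum fun b hb => ?_
  by_cases h1 : b ∈ K
  · simp [h1, hKK h1]
  · by_cases h2 : b ∈ K'
    · simp [h1, h2, hgh b hb]
    · simp [h1, h2]

/-- Because `g ≤ h`, enlarging `K` never raises the cost. Every `K` with at most two elements lies
in `C` itself or in a listed pair; the pairs include `b₁ = b₂`, which does no harm. -/
theorem min_over_pairs (hgh : ∀ b ∈ C, g b ≤ h b) {m : ℕ}
    (hm : m = if C.card ≤ 2 then ∑ b ∈ C, g b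
      else sInf {m | ∃ b₁ ∈ C, ∃ b₂ ∈ C, m = ∑ b ∈ {b₁, b₂}, g b + ∑ b ∈ C \ {b₁, b₂}, h b}) :
    (∃ K ⊆ C, K.card ≤ 2 ∧ (∑ b ∈ C, if b ∈ K then g b else h b) = m) ∧
      ∀ K ⊆ C, K.card ≤ 2 → m ≤ ∑ b ∈ C, if b ∈ K then g b else h b := by
  have hsub : ∀ {b₁ b₂}, b₁ ∈ C → b₂ ∈ C → ({b₁, b₂} : Finset ι) ⊆ C := by
    intro b₁ b₂ h₁ h₂ y hy
    simp only [Finset.mem_insert, Finset.mem_singleton] at hy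
    rcases hy with rfl | rfl <;> assumption
  split_ifs at hm with hC
  · refine ⟨⟨C, subset_rfl, hC, ?_⟩, fun K hK _ => ?_⟩
    · rw [hm]; exact Finset.sum_congr rfl fun b hb => by simp [hb]
    · refine le_of_eq_of_le ?_ (sum_ite_le_of_subset hgh hK)
      rw [hm]; exact Finset.sum_congr rfl fun b hb => by simp [hb]
  · obtain ⟨c, hc⟩ : C.Nonempty := Finset.card_pos.1 (by omega)
    constructor
    · obtain ⟨b₁, h₁, b₂, h₂, he⟩ := Nat.sInf_mem (s := {m | ∃ b₁ ∈ C, ∃ b₂ ∈ C,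
        m = ∑ b ∈ {b₁, b₂}, g b + ∑ b ∈ C \ {b₁, b₂}, h b}) ⟨_, c, hc, c, hc, rfl⟩
      exact ⟨{b₁, b₂}, hsub h₁ h₂, Finset.card_le_two, by
        rw [← sum_add_sum_sdiff (hsub h₁ h₂), ← he, ← hm]⟩
    · intro K hK hK2
      -- Smaller sets are padded by repeating an element, or by `c` if `K` is empty.
      obtain ⟨b₁, h₁, b₂, h₂, hb⟩ : ∃ b₁ ∈ C, ∃ b₂ ∈ C, K ⊆ {b₁, b₂} := by
        obtain h | h | h : K.card = 0 ∨ K.card = 1 ∨ K.card = 2 := by omega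
        · rw [Finset.card_eq_zero] at h
          exact ⟨c, hc, c, hc, by simp [h]⟩
        · obtain ⟨a, rfl⟩ := Finset.card_eq_one.1 h
          exact ⟨a, hK (by simp), a, hK (by simp), by simp⟩
        · obtain ⟨a, b, -, rfl⟩ := Finset.card_eq_two.1 h
          exact ⟨a, hK (by simp), b, hK (by simp), subset_rfl⟩
      refine le_trans ?_ (sum_ite_le_of_subset hgh hb)
      rw [hm, ← sum_add_sum_sdiff (hsub h₁ h₂)]
      exact Nat.sInf_le ⟨b₁, h₁, b₂, h₂, rfl⟩

/-- The argument of `min_over_pairs` with one place instead of two. -/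
theorem min_over_singletons (hgh : ∀ b ∈ C, g b ≤ h b) (hC : C.Nonempty) {m : ℕ}
    (hm : m = if C.card = 1 then ∑ b ∈ C, g b
      else sInf {m | ∃ b₁ ∈ C, m = g b₁ + ∑ b ∈ C \ {b₁}, h b}) :
    (∃ K ⊆ C, K.card ≤ 1 ∧ (∑ b ∈ C, if b ∈ K then g b else h b) = m) ∧
      ∀ K ⊆ C, K.card ≤ 1 → m ≤ ∑ b ∈ C, if b ∈ K then g b else h b := by
  obtain ⟨c, hc⟩ := hC
  have hval : ∀ b ∈ C, g b + ∑ b ∈ C \ {b}, h b =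
      ∑ a ∈ C, if a ∈ ({b} : Finset ι) then g a else h a := by
    intro b hb
    rw [← sum_add_sum_sdiff (by simpa using hb), Finset.sum_singleton]
  split_ifs at hm with hC
  · refine ⟨⟨C, subset_rfl, hC.le, ?_⟩, fun K hK _ => ?_⟩
    · rw [hm]; exact Finset.sum_congr rfl fun b hb => by simp [hb]
    · refine le_of_eq_of_le ?_ (sum_ite_le_of_subset hgh hK)
      rw [hm]; exact Finset.sum_congr rfl fun b hb => by simp [hb]
  · constructor
    · obtain ⟨b₁, h₁, he⟩ := Nat.sInf_mem (s := {m | ∃ b₁ ∈ C,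
        m = g b₁ + ∑ b ∈ C \ {b₁}, h b}) ⟨_, c, hc, rfl⟩
      exact ⟨{b₁}, by simpa using h₁, by simp, by rw [← hval _ h₁, ← he, ← hm]⟩
    · intro K hK hK1
      obtain ⟨b₁, h₁, hb⟩ : ∃ b₁ ∈ C, K ⊆ {b₁} := by
        obtain h | h : K.card = 0 ∨ K.card = 1 := by omega
        · rw [Finset.card_eq_zero] at h
          exact ⟨c, hc, by simp [h]⟩
        · obtain ⟨a, rfl⟩ := Finset.card_eq_one.1 h
          exact ⟨a, hK (by simp), subset_rfl⟩
      refine le_trans ?_ (sum_ite_le_of_subset hgh hb)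
      rw [hm, ← hval _ h₁]
      exact Nat.sInf_le ⟨b₁, h₁, rfl⟩

end Minima

/-! ### Weights of unions over disjoint pieces -/

section Assembly

open scoped Classical

variable {V : Type u} {ι : Type*} {C : Finset ι} {D S : ι → Finset V}

theorem sum_biUnion_of_subset (w : V → ℕ)
    (hD : ∀ x ∈ C, ∀ y ∈ C, ∀ z, z ∈ D x → z ∈ D y → x = y) (hS : ∀ y ∈ C, S y ⊆ D y) :
    ∑ v ∈ C.biUnion S, w v = ∑ y ∈ C, ∑ v ∈ S y, w v := by
  refine Finset.sum_biUnion fun x hx y hy hxy => Finset.disjoint_left.2 fun z hz hz' => ?_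
  exact hxy (hD x hx y hy z (hS x hx hz) (hS y hy hz'))

end Assembly

/-! ### Correctness of the values at a node -/

section Correct

open scoped Classical

variable {V : Type u} [Fintype V] {G : SimpleGraph V} {w : V → ℕ} {ρ : BCNode G}

/-- The meaning of the values at the node `x` of a cutpoint `v`.  For `f₃` it suffices to delete
vertices of `G_v`, and only one vertex of the parent of `v` has to be kept. -/
structure CutCorrect (w : V → ℕ) (ρ : BCNode G) (v : V) (x : BCNode G) (Z : Values) : Prop where
  f₁ : IsMinWeight w (fun S => S ⊆ below G ρ x ∧ ClawFreeOn G (below G ρ x \ S) ∧ v ∈ S) Z.f₁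
  f₂ : IsMinWeight w (fun S => S ⊆ below G ρ x ∧ ClawFreeOn G (below G ρ x \ S) ∧ v ∉ S) Z.f₂
  f₃_exists : ∀ B hB, IsChild (blockCutpointGraph G) ρ (.block B hB) x →
    ∃ S ⊆ below G ρ x, v ∉ S ∧ ClawFreeOn G ((below G ρ x ∪ B) \ S) ∧ ∑ u ∈ S, w u ≤ Z.f₃
  f₃_le : ∀ B hB, IsChild (blockCutpointGraph G) ρ (.block B hB) x →
    ∀ S ⊆ below G ρ x, v ∉ S → ∀ b ∈ B, b ≠ v → ClawFreeOn G (insert b (below G ρ x) \ S) →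
      Z.f₃ ≤ ∑ u ∈ S, w u

/-- The meaning of the values at the node `x` of a block with parent `p`. -/
structure BlockCorrect (w : V → ℕ) (ρ : BCNode G) (p : V) (x : BCNode G) (Z : Values) : Prop where
  f₁ : IsMinWeight w (fun S => S ⊆ below G ρ x \ {p} ∧ ClawFreeOn G ((below G ρ x \ {p}) \ S) ∧
    x.verts \ {p} ⊆ S) Z.f₁
  f₂ : IsMinWeight w (fun S => S ⊆ below G ρ x \ {p} ∧ ClawFreeOn G ((below G ρ x \ {p}) \ S)) Z.f₂
  f₃ : IsMinWeight w (fun S => S ⊆ below G ρ x ∧ ClawFreeOn G (below G ρ x \ S) ∧ p ∉ S) Z.f₃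

/-- If at least three blocks through `v` have a further vertex in `A`, there is a claw. -/
theorem clawAt_of_three_le_card (hG : IsBlockGraph G) {A : Finset V} {v : V}
    (K : Finset (BCNode G))
    (hK : ∀ y ∈ K, ∃ B hB, y = .block B hB ∧ v ∈ B ∧ ∃ a ∈ B, a ≠ v ∧ a ∈ A)
    (hcard : 3 ≤ K.card) : ClawAt G A v := by
  obtain ⟨e⟩ := Function.Embedding.nonempty_of_card_le (α := Fin 3) (β := K) (by simpa using hcard)
  choose B hB hy hv a ha hav haA using fun i : Fin 3 => hK (e i) (e i).2
  refine clawAt_of_blocks hG hB (fun i j hij => e.injective (Subtype.ext ?_)) hv ha hav haA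
  rw [hy i, hy j]
  simp [hij]

variable [Nontrivial V] (hG : IsBlockGraph G) (hconn : G.Connected)
  (hT : IsRootedTree (blockCutpointGraph G) ρ)

/-! ### The recurrences at a cutpoint -/

section Cut

variable {v : V} {hv : IsCutpoint G v} {F : BCNode G → Values}
  (hF : ∀ y ∈ children (blockCutpointGraph G) ρ (.cut v hv), BlockCorrect w ρ v y (F y))

include hG hconn hT

theorem eq_of_mem_below_sdiff {v : V} {hv : IsCutpoint G v} :
    ∀ x ∈ children (blockCutpointGraph G) ρ (.cut v hv),
    ∀ y ∈ children (blockCutpointGraph G) ρ (.cut v hv),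
    ∀ z, z ∈ below G ρ x \ {v} → z ∈ below G ρ y \ {v} → x = y := by
  intro x hx y hy z hzx hzy
  rw [Finset.mem_sdiff, Finset.mem_singleton] at hzx hzy
  by_contra hne
  obtain ⟨hz, h⟩ := exists_eq_cut_of_mem_below hG hconn hT (mem_children.1 hx) (mem_children.1 hy)
    hne hzx.1 hzy.1
  cases h
  exact hzx.2 rfl

/-- By `eq_of_mem_below_sdiff` the pieces on the right are disjoint, so weights add over the child
blocks. -/
theorem below_cut_eq (v : V) (hv : IsCutpoint G v) : below G ρ (.cut v hv) =
    insert v ((children (blockCutpointGraph G) ρ (.cut v hv)).biUnion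
      fun y => below G ρ y \ {v}) := by
  ext u
  simp only [Finset.mem_insert, Finset.mem_biUnion, Finset.mem_sdiff, Finset.mem_singleton,
    mem_children]
  constructor
  · intro hu
    obtain ⟨y, hy, hu⟩ := mem_below_cut.1 hu
    by_cases huv : u = v
    · exact .inl huv
    · exact .inr ⟨y, hy, hu, huv⟩
  · rintro (rfl | ⟨y, hy, hu, -⟩)
    · exact mem_below_cut_self hG hconn hT hv
    · exact below_subset hy hu

/-- A child block outside `K` has lost everything but `v`, so the surviving neighbours of `v` in
`G_v` are covered by the cliques in `K`. -/
theorem mem_verts_of_adj_cut {S : Finset V} {K : Finset (BCNode G)}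
    (hK : ∀ y ∈ children (blockCutpointGraph G) ρ (.cut v hv), y ∉ K → y.verts \ {v} ⊆ S)
    {z : V} (hz : z ∈ below G ρ (.cut v hv)) (hzS : z ∉ S) (h : G.Adj v z) :
    ∃ y ∈ K, z ∈ y.verts := by
  obtain ⟨y, hy, hzy⟩ := mem_below_cut.1 hz
  obtain ⟨B, hB, rfl, -⟩ := hy.exists_block
  have hzB := mem_block_of_adj_parent hG hconn hT hy hzy h
  refine ⟨.block B hB, ?_, hzB⟩
  by_contra hyK
  exact hzS (hK _ (mem_children.2 hy) hyK (by simp [BCNode.verts, hzB, h.ne']))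

include hF

/-- The lower bound shared by `f₂(v)` and `f₃(v)`: `S` restricts to an admissible set on each piece,
where `K` contains every child block that keeps a vertex besides `v`. -/
theorem sum_le_of_clawFreeOn_cut {S : Finset V} (hvS : v ∉ S)
    (hS : S ⊆ below G ρ (.cut v hv)) (hcf : ClawFreeOn G (below G ρ (.cut v hv) \ S))
    (K : Finset (BCNode G))
    (hK : ∀ y ∈ children (blockCutpointGraph G) ρ (.cut v hv), y ∉ K → y.verts \ {v} ⊆ S) :
    (∑ y ∈ children (blockCutpointGraph G) ρ (.cut v hv), if y ∈ K then (F y).f₃ else (F y).f₁) ≤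
      ∑ u ∈ S, w u := by
  have hSE : S ∩ (children (blockCutpointGraph G) ρ (.cut v hv)).biUnion
      (fun y => below G ρ y \ {v}) = S := by
    refine Finset.inter_eq_left.2 fun u hu => ?_
    have := hS hu
    rw [below_cut_eq hG hconn hT, Finset.mem_insert] at this
    exact this.resolve_left fun h => hvS (h ▸ hu)
  have hsum := sum_inter_biUnion (w := w) _ _
    (eq_of_mem_below_sdiff hG hconn hT (v := v) (hv := hv)) S
  rw [hSE] at hsum
  rw [← hsum]
  refine Finset.sum_le_sum fun y hy => ?_
  have hsub := below_subset (mem_children.1 hy)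
  split_ifs with hyK
  · refine (hF y hy).f₃.le ⟨fun z hz => ?_, hcf.mono fun z hz => ?_, fun h => hvS ?_⟩
    · exact (Finset.mem_sdiff.1 (Finset.mem_inter.1 hz).2).1
    · rw [Finset.mem_sdiff, Finset.mem_inter, Finset.mem_sdiff, Finset.mem_singleton] at hz
      refine Finset.mem_sdiff.2 ⟨hsub hz.1, fun hzS => hz.2 ⟨hzS, hz.1, ?_⟩⟩
      rintro rfl; exact hvS hzS
    · exact (Finset.mem_inter.1 h).1
  · refine (hF y hy).f₁.le ⟨Finset.inter_subset_right, hcf.mono fun z hz => ?_, fun z hz => ?_⟩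
    · rw [Finset.mem_sdiff, Finset.mem_inter] at hz
      exact Finset.mem_sdiff.2 ⟨hsub (Finset.mem_sdiff.1 hz.1).1, fun h => hz.2 ⟨h, hz.1⟩⟩
    · obtain ⟨B, hB, rfl, -⟩ := (mem_children.1 hy).exists_block
      refine Finset.mem_inter.2 ⟨hK _ hy hyK hz, ?_⟩
      rw [Finset.mem_sdiff] at hz ⊢
      exact ⟨mem_below_of_mem hz.1, hz.2⟩

/-- The upper bound shared by `f₂(v)` and `f₃(v)`: unite optimal sets of the pieces. Vertices other
than `v` have all their neighbours in their own piece, so only `v` remains to be checked, and `K`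
may have any size. Claws are taken in `Sᶜ` so that the result applies to `G_v` and to `G_v^+`. -/
theorem exists_sum_le_cut (K : Finset (BCNode G)) :
    ∃ S ⊆ below G ρ (.cut v hv), v ∉ S ∧
      (∑ u ∈ S, w u ≤ ∑ y ∈ children (blockCutpointGraph G) ρ (.cut v hv),
        if y ∈ K then (F y).f₃ else (F y).f₁) ∧
      (∀ u ∈ below G ρ (.cut v hv) \ S, u ≠ v → ¬ ClawAt G Sᶜ u) ∧
      ∀ y ∈ children (blockCutpointGraph G) ρ (.cut v hv), y ∉ K → y.verts \ {v} ⊆ S := by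
  have hex : ∀ y ∈ children (blockCutpointGraph G) ρ (.cut v hv), ∃ S ⊆ below G ρ y \ {v},
      (∑ u ∈ S, w u ≤ if y ∈ K then (F y).f₃ else (F y).f₁) ∧
      (∀ u ∈ below G ρ y \ {v}, u ∉ S → ¬ ClawAt G (below G ρ y \ S) u) ∧
      (y ∉ K → y.verts \ {v} ⊆ S) := by
    intro y hy
    by_cases hyK : y ∈ K
    · obtain ⟨S, ⟨h1, h2, h3⟩, h4⟩ := (hF y hy).f₃.exists_le
      refine ⟨S, fun u hu => ?_, by simpa [hyK] using h4, fun u hu huS => ?_, fun h => absurd hyK h⟩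
      · rw [Finset.mem_sdiff, Finset.mem_singleton]
        exact ⟨h1 hu, fun h => h3 (h ▸ hu)⟩
      · exact h2 u (Finset.mem_sdiff.2 ⟨(Finset.mem_sdiff.1 hu).1, huS⟩)
    · obtain ⟨S, ⟨h1, h2, h3⟩, h4⟩ := (hF y hy).f₁.exists_le
      refine ⟨S, h1, by simpa [hyK] using h4, fun u hu huS hc => ?_, fun _ => h3⟩
      -- The `f₁` set is known to work only without `v`. If `v` were a leaf of a claw at `u`, then
      -- `u` would lie in the block itself, where all vertices but `v` are deleted.
      refine h2 u (Finset.mem_sdiff.2 ⟨hu, huS⟩) (hc.mono fun z hz huz => ?_)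
      rw [Finset.mem_sdiff] at hz
      refine Finset.mem_sdiff.2 ⟨Finset.mem_sdiff.2 ⟨hz.1, fun hzv => huS (h3 ?_)⟩, hz.2⟩
      rw [Finset.mem_singleton] at hzv
      subst hzv
      rw [Finset.mem_sdiff] at hu ⊢
      obtain ⟨B, hB, rfl, -⟩ := (mem_children.1 hy).exists_block
      exact ⟨mem_block_of_adj_parent hG hconn hT (mem_children.1 hy) hu.1 huz.symm, hu.2⟩
  choose! S h1 h2 h3 h4 using hex
  have hdis := eq_of_mem_below_sdiff hG hconn hT (v := v) (hv := hv)
  refine ⟨(children (blockCutpointGraph G) ρ (.cut v hv)).biUnion S, ?_, ?_, ?_, ?_, ?_⟩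
  · rw [below_cut_eq hG hconn hT]
    exact (Finset.biUnion_mono h1).trans (Finset.subset_insert _ _)
  · intro h
    obtain ⟨y, hy, hvy⟩ := Finset.mem_biUnion.1 h
    simpa using h1 y hy hvy
  · rw [sum_biUnion_of_subset w hdis h1]
    exact Finset.sum_le_sum h2
  · intro u hu huv hc
    rw [Finset.mem_sdiff] at hu
    obtain ⟨y, hy, huy⟩ := mem_below_cut.1 hu.1
    rw [← mem_children] at hy
    have hSy : S y ⊆ (children (blockCutpointGraph G) ρ (.cut v hv)).biUnion S :=
      Finset.subset_biUnion_of_mem S hy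
    refine h3 y hy u (by simp [huy, huv]) (fun h => hu.2 (hSy h)) (hc.mono fun z hz huz => ?_)
    exact Finset.mem_sdiff.2 ⟨mem_below_block_of_adj hG hconn hT (mem_children.1 hy) huy huv huz,
      fun h => Finset.mem_compl.1 hz (hSy h)⟩
  · exact fun y hy hyK => (h4 y hy hyK).trans (Finset.subset_biUnion_of_mem S hy)

/-- In the lower bounds for `f₂` and `f₃`, `K` consists of the child blocks that keep a vertex
besides `v`; a claw at `v` appears once too many of them do. -/
theorem cutCorrect_step (hle : ∀ y ∈ children (blockCutpointGraph G) ρ (.cut v hv),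
    (F y).f₃ ≤ (F y).f₁) : CutCorrect w ρ v (.cut v hv) (step G w ρ F (.cut v hv)) := by
  have hdis := eq_of_mem_below_sdiff hG hconn hT (v := v) (hv := hv)
  have hdef := below_cut_eq hG hconn hT v hv
  have hfilter : ∀ S : Finset V, ∀ y ∈ children (blockCutpointGraph G) ρ (.cut v hv),
      y ∉ (children (blockCutpointGraph G) ρ (.cut v hv)).filter
        (fun y => ¬ y.verts \ {v} ⊆ S) → y.verts \ {v} ⊆ S := by
    intro S y hy h
    by_contra hn
    exact h (Finset.mem_filter.2 ⟨hy, hn⟩)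
  have halive : ∀ {S A : Finset V}, below G ρ (.cut v hv) \ S ⊆ A →
      ∀ y ∈ (children (blockCutpointGraph G) ρ (.cut v hv)).filter
        (fun y => ¬ y.verts \ {v} ⊆ S),
        ∃ B hB, y = .block B hB ∧ v ∈ B ∧ ∃ a ∈ B, a ≠ v ∧ a ∈ A := by
    intro S A hA y hy
    rw [Finset.mem_filter, Finset.not_subset] at hy
    obtain ⟨hy, a, ha, haS⟩ := hy
    obtain ⟨B, hB, rfl, hvB⟩ := (mem_children.1 hy).exists_block
    rw [Finset.mem_sdiff, Finset.mem_singleton] at ha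
    exact ⟨B, hB, rfl, hvB, a, ha.1, ha.2, hA (Finset.mem_sdiff.2
      ⟨below_subset (mem_children.1 hy) (mem_below_of_mem ha.1), haS⟩)⟩
  have hclique : ∀ y ∈ children (blockCutpointGraph G) ρ (.cut v hv),
      G.IsClique (↑y.verts : Set V) := by
    intro y hy
    obtain ⟨B, hB, rfl, -⟩ := (mem_children.1 hy).exists_block
    exact hG B hB
  -- The recurrences enter by unfolding `step`. `K₂` and `K₁` are optimal choices of the child
  -- blocks that may keep a further vertex.
  obtain ⟨⟨K₂, hK₂, hK₂c, hK₂m⟩, hmin₂⟩ := min_over_pairs hle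
    (m := (step G w ρ F (.cut v hv)).f₂) rfl
  obtain ⟨c, hc⟩ := exists_isChild_cut hG hconn hT hv
  obtain ⟨⟨K₁, hK₁, hK₁c, hK₁m⟩, hmin₁⟩ := min_over_singletons hle ⟨c, mem_children.2 hc⟩
    (m := (step G w ρ F (.cut v hv)).f₃) rfl
  refine ⟨isMinWeight_of ?_ ?_, isMinWeight_of ?_ ?_, ?_, ?_⟩
  · have hex : ∀ y ∈ children (blockCutpointGraph G) ρ (.cut v hv), ∃ S,
        (S ⊆ below G ρ y \ {v} ∧ ClawFreeOn G ((below G ρ y \ {v}) \ S)) ∧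
          ∑ u ∈ S, w u ≤ (F y).f₂ := fun y hy => (hF y hy).f₂.exists_le
    choose! S h1 h2 using hex
    have hS := fun y hy => (h1 y hy).1
    refine ⟨insert v ((children (blockCutpointGraph G) ρ (.cut v hv)).biUnion S),
      ⟨?_, ?_, by simp⟩, ?_⟩
    · rw [hdef]
      exact Finset.insert_subset_insert _ (Finset.biUnion_mono hS)
    · intro u hu hc
      rw [Finset.mem_sdiff, Finset.mem_insert, not_or] at hu
      obtain ⟨y, hy, huy⟩ := mem_below_cut.1 hu.1
      have hy' := mem_children.2 hy
      have hSy : S y ⊆ (children (blockCutpointGraph G) ρ (.cut v hv)).biUnion S :=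
        Finset.subset_biUnion_of_mem S hy'
      refine (h1 y hy').2 u ?_ (hc.mono fun z hz huz => ?_)
      · simp only [Finset.mem_sdiff, Finset.mem_singleton]
        exact ⟨⟨huy, hu.2.1⟩, fun h => hu.2.2 (hSy h)⟩
      · rw [Finset.mem_sdiff, Finset.mem_insert, not_or] at hz
        simp only [Finset.mem_sdiff, Finset.mem_singleton]
        exact ⟨⟨mem_below_block_of_adj hG hconn hT hy huy hu.2.1 huz, hz.2.1⟩,
          fun h => hz.2.2 (hSy h)⟩
    · rw [Finset.sum_insert, sum_biUnion_of_subset w hdis hS]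
      · exact Nat.add_le_add_left (Finset.sum_le_sum h2) _
      · intro h
        obtain ⟨y, hy, hvy⟩ := Finset.mem_biUnion.1 h
        simpa using hS y hy hvy
  · rintro S ⟨hS, hcf, hvS⟩
    have hsum := sum_inter_biUnion (w := w) _ _ hdis S
    have hSE : insert v (S ∩ (children (blockCutpointGraph G) ρ (.cut v hv)).biUnion
        (fun y => below G ρ y \ {v})) = S := by
      ext z
      rw [Finset.mem_insert, Finset.mem_inter]
      constructor
      · rintro (rfl | h)
        exacts [hvS, h.1]
      · intro hz
        have := hS hz
        rw [hdef, Finset.mem_insert] at this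
        exact this.imp_right fun h => ⟨hz, h⟩
    rw [← hSE, Finset.sum_insert (by simp), ← hsum]
    refine Nat.add_le_add_left (Finset.sum_le_sum fun y hy => ?_) _
    refine (hF y hy).f₂.le ⟨Finset.inter_subset_right, hcf.mono fun z hz => ?_⟩
    rw [Finset.mem_sdiff, Finset.mem_inter] at hz
    exact Finset.mem_sdiff.2 ⟨below_subset (mem_children.1 hy) (Finset.mem_sdiff.1 hz.1).1,
      fun h => hz.2 ⟨h, hz.1⟩⟩
  · obtain ⟨S, h1, h2, h3, h4, h5⟩ := exists_sum_le_cut hG hconn hT hF K₂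
    refine ⟨S, ⟨h1, fun u hu => ?_, h2⟩, h3.trans hK₂m.le⟩
    by_cases huv : u = v
    · subst huv
      refine not_clawAt_of_cliques K₂ BCNode.verts hK₂c (fun y hy => hclique y (hK₂ hy)) ?_
      intro z hz huz
      rw [Finset.mem_sdiff] at hz
      exact mem_verts_of_adj_cut hG hconn hT h5 hz.1 hz.2 huz
    · exact fun hc => h4 u hu huv (hc.mono fun z hz _ =>
        Finset.mem_compl.2 (Finset.mem_sdiff.1 hz).2)
  · rintro S ⟨hS, hcf, hvS⟩
    refine le_trans (hmin₂ _ (Finset.filter_subset _ _) ?_)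
      (sum_le_of_clawFreeOn_cut hG hconn hT hF hvS hS hcf _ (hfilter S))
    by_contra hcard
    exact hcf v (Finset.mem_sdiff.2 ⟨mem_below_cut_self hG hconn hT hv, hvS⟩)
      (clawAt_of_three_le_card hG _ (halive subset_rfl) (by omega))
  · intro B hB hBv
    obtain ⟨S, h1, h2, h3, h4, h5⟩ := exists_sum_le_cut hG hconn hT hF K₁
    refine ⟨S, h1, h2, fun u hu => ?_, h3.trans hK₁m.le⟩
    rw [Finset.mem_sdiff, Finset.mem_union] at hu
    by_cases huv : u = v
    · subst huv
      -- The parent block is one of the two cliques around `v`, which leaves room for one child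
      -- block.
      refine not_clawAt_of_cliques (insert (.block B hB) K₁) BCNode.verts
        ((Finset.card_insert_le _ _).trans (by omega)) ?_ ?_
      · intro y hy
        rcases Finset.mem_insert.1 hy with rfl | hy
        exacts [hG B hB, hclique y (hK₁ hy)]
      · intro z hz huz
        rw [Finset.mem_sdiff, Finset.mem_union] at hz
        rcases hz.1 with hz' | hz'
        · obtain ⟨y, hy, hzy⟩ := mem_verts_of_adj_cut hG hconn hT h5 hz' hz.2 huz
          exact ⟨y, Finset.mem_insert_of_mem hy, hzy⟩
        · exact ⟨_, Finset.mem_insert_self _ _, hz'⟩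
    · by_cases hub : u ∈ below G ρ (.cut v hv)
      · exact fun hc => h4 u (Finset.mem_sdiff.2 ⟨hub, hu.2⟩) huv (hc.mono fun z hz _ =>
          Finset.mem_compl.2 (Finset.mem_sdiff.1 hz).2)
      -- A vertex of the parent block outside `G_v` sees only that block.
      · refine not_clawAt_of_cliques {BCNode.block B hB} BCNode.verts (by simp) ?_ ?_
        · intro y hy
          rw [Finset.mem_singleton.1 hy]
          exact hG B hB
        · intro z hz huz
          refine ⟨_, Finset.mem_singleton_self _, ?_⟩
          rw [Finset.mem_sdiff, Finset.mem_union] at hz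
          rcases hz.1 with hz' | hz'
          · by_cases hzv : z = v
            · subst hzv; exact hBv.1
            · exact absurd (mem_below_cut_of_adj hG hconn hT hz' hzv huz.symm) hub
          · exact hz'
  · intro B hB hBv S hS hvS b hb hbv hcf
    have hbD : b ∉ below G ρ (.cut v hv) := fun h =>
      hbv (eq_of_mem_below_cut hG hconn hT hBv h hb)
    have hsub : below G ρ (.cut v hv) \ S ⊆ insert b (below G ρ (.cut v hv)) \ S :=
      Finset.sdiff_subset_sdiff (Finset.subset_insert _ _) subset_rfl
    refine le_trans (hmin₁ _ (Finset.filter_subset _ _) ?_)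
      (sum_le_of_clawFreeOn_cut hG hconn hT hF hvS hS (hcf.mono hsub) _ (hfilter S))
    by_contra hcard
    -- The survivor `b` makes the parent block count, so two surviving child blocks already give a
    -- claw at `v`.
    refine hcf v (hsub (Finset.mem_sdiff.2 ⟨mem_below_cut_self hG hconn hT hv, hvS⟩))
      (clawAt_of_three_le_card hG (insert (.block B hB)
        ((children (blockCutpointGraph G) ρ (.cut v hv)).filter
          (fun y => ¬ y.verts \ {v} ⊆ S))) ?_ ?_)
    · intro y hy
      rcases Finset.mem_insert.1 hy with rfl | hy
      · exact ⟨B, hB, rfl, hBv.1, b, hb, hbv,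
          Finset.mem_sdiff.2 ⟨Finset.mem_insert_self _ _, fun h => hbD (hS h)⟩⟩
      · exact halive hsub y hy
    · rw [Finset.card_insert_of_notMem]
      · omega
      · intro h
        have := mem_children.1 (Finset.mem_filter.1 h).1
        exact hBv.notMem_subtree this.mem_subtree

end Cut

end Correct

/-! ### The recurrences at a block -/

theorem IsChild.ne_parent {V : Type u} {G : SimpleGraph V} {ρ : BCNode G} {p v : V} {hp : IsCutpoint G p}
    {hv : IsCutpoint G v} {B : Finset V} {hB : IsBlock G B}
    (hx : IsChild (blockCutpointGraph G) ρ (.cut p hp) (.block B hB))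
    (h : IsChild (blockCutpointGraph G) ρ (.block B hB) (.cut v hv)) : v ≠ p := by
  rintro rfl
  exact hx.notMem_subtree h.mem_subtree

section BlockStep

open scoped Classical

variable {V : Type u} [Fintype V] {G : SimpleGraph V} {w : V → ℕ} {ρ : BCNode G}

/-- The separate rule for childless blocks is the general formula with empty sums. -/
theorem step_block_f₁ (F : BCNode G → Values) (B : Finset V) (hB : IsBlock G B) :
    (step G w ρ F (.block B hB)).f₁ = simplicialWeight G w B +
      ∑ y ∈ children (blockCutpointGraph G) ρ (.block B hB), (F y).f₁ := by
  by_cases h : children (blockCutpointGraph G) ρ (.block B hB) = ∅ <;> simp [step, h]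

theorem step_block_f₃ (F : BCNode G → Values) (B : Finset V) (hB : IsBlock G B) :
    (step G w ρ F (.block B hB)).f₃ =
      ∑ y ∈ children (blockCutpointGraph G) ρ (.block B hB), min (F y).f₁ (F y).f₃ := by
  by_cases h : children (blockCutpointGraph G) ρ (.block B hB) = ∅ <;> simp [step, h]

theorem step_block_f₂_le (F : BCNode G → Values) (B : Finset V) (hB : IsBlock G B) :
    (step G w ρ F (.block B hB)).f₂ ≤
      ∑ y ∈ children (blockCutpointGraph G) ρ (.block B hB), min (F y).f₁ (F y).f₃ := by
  by_cases h : children (blockCutpointGraph G) ρ (.block B hB) = ∅ <;> simp [step, h]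

theorem step_block_f₂_le_of_mem (F : BCNode G → Values) (B : Finset V) (hB : IsBlock G B)
    {y : BCNode G} (hy : y ∈ children (blockCutpointGraph G) ρ (.block B hB)) :
    (step G w ρ F (.block B hB)).f₂ ≤ simplicialWeight G w B + (F y).f₂ +
      ∑ z ∈ children (blockCutpointGraph G) ρ (.block B hB) \ {y}, (F z).f₁ := by
  have h := Finset.ne_empty_of_mem hy
  simp only [step, if_neg h]
  exact (min_le_right _ _).trans (Nat.sInf_le ⟨y, hy, rfl⟩)

theorem step_block_f₂_eq (F : BCNode G → Values) (B : Finset V) (hB : IsBlock G B) :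
    (step G w ρ F (.block B hB)).f₂ =
      ∑ y ∈ children (blockCutpointGraph G) ρ (.block B hB), min (F y).f₁ (F y).f₃ ∨
    ∃ y ∈ children (blockCutpointGraph G) ρ (.block B hB),
      (step G w ρ F (.block B hB)).f₂ = simplicialWeight G w B + (F y).f₂ +
        ∑ z ∈ children (blockCutpointGraph G) ρ (.block B hB) \ {y}, (F z).f₁ := by
  by_cases h : children (blockCutpointGraph G) ρ (.block B hB) = ∅
  · left; simp [step, h]
  · obtain ⟨c, hc⟩ := Finset.nonempty_iff_ne_empty.2 h
    simp only [step, if_neg h]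
    rcases min_choice (∑ y ∈ children (blockCutpointGraph G) ρ (.block B hB),
        min (F y).f₁ (F y).f₃)
      (sInf {m | ∃ v₁ ∈ children (blockCutpointGraph G) ρ (.block B hB),
        m = simplicialWeight G w B + (F v₁).f₂ +
          ∑ v ∈ children (blockCutpointGraph G) ρ (.block B hB) \ {v₁}, (F v).f₁}) with h' | h'
    · exact .inl h'
    · rw [h']
      exact .inr (Nat.sInf_mem (s := {m | ∃ v₁ ∈ children (blockCutpointGraph G) ρ (.block B hB),
        m = simplicialWeight G w B + (F v₁).f₂ +
          ∑ v ∈ children (blockCutpointGraph G) ρ (.block B hB) \ {v₁}, (F v).f₁})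
        ⟨_, c, hc, rfl⟩)

/-- This is the inequality `g ≤ h` needed for the minima at the parent cutpoint. -/
theorem step_block_f₃_le_f₁ (F : BCNode G → Values) (B : Finset V) (hB : IsBlock G B) :
    (step G w ρ F (.block B hB)).f₃ ≤ (step G w ρ F (.block B hB)).f₁ := by
  rw [step_block_f₁, step_block_f₃]
  exact (Finset.sum_le_sum fun y _ => min_le_left _ _).trans (Nat.le_add_left _ _)

/-- The vertices of `B` that are not cutpoints of `G`. -/
noncomputable def simplicialVerts (G : SimpleGraph V) (B : Finset V) : Finset V :=
  {u ∈ B | ¬ IsCutpoint G u}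

theorem CutCorrect.f₁_le_sum_inter {p v : V} {hv : IsCutpoint G v} {B S : Finset V}
    {hB : IsBlock G B} {Z : Values} (hZ : CutCorrect w ρ v (.cut v hv) Z)
    (hcf : ClawFreeOn G ((below G ρ (.block B hB) \ {p}) \ S))
    (hvS : v ∈ S) (hsub : below G ρ (.cut v hv) ⊆ below G ρ (.block B hB) \ {p})
    (hvv : v ∈ below G ρ (.cut v hv)) :
    Z.f₁ ≤ ∑ u ∈ S ∩ below G ρ (.cut v hv), w u := by
  refine hZ.f₁.le ⟨Finset.inter_subset_right, hcf.mono fun z hz => ?_,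
    Finset.mem_inter.2 ⟨hvS, hvv⟩⟩
  rw [Finset.mem_sdiff, Finset.mem_inter] at hz
  exact Finset.mem_sdiff.2 ⟨hsub hz.1, fun h => hz.2 ⟨h, hz.1⟩⟩

variable [Nontrivial V] (hG : IsBlockGraph G) (hconn : G.Connected)
  (hT : IsRootedTree (blockCutpointGraph G) ρ)
  {p : V} {hp : IsCutpoint G p} {B : Finset V} {hB : IsBlock G B}

include hG hconn hT

theorem eq_of_mem_below : ∀ x ∈ children (blockCutpointGraph G) ρ (.block B hB),
    ∀ y ∈ children (blockCutpointGraph G) ρ (.block B hB),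
    ∀ z, z ∈ below G ρ x → z ∈ below G ρ y → x = y := by
  intro x hx y hy z hzx hzy
  by_contra hne
  obtain ⟨hz, h⟩ := exists_eq_cut_of_mem_below hG hconn hT (mem_children.1 hx) (mem_children.1 hy)
    hne hzx hzy
  cases h

theorem disjoint_simplicialVerts : Disjoint (simplicialVerts G B)
    ((children (blockCutpointGraph G) ρ (.block B hB)).biUnion (below G ρ)) := by
  rw [Finset.disjoint_left]
  intro u hu hu'
  rw [simplicialVerts, Finset.mem_filter] at hu
  obtain ⟨y, hy, huy⟩ := Finset.mem_biUnion.1 hu'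
  rw [mem_children] at hy
  obtain ⟨v, hv, rfl, -⟩ := hy.exists_cut
  obtain rfl := eq_of_mem_below_cut hG hconn hT hy huy hu.1
  exact hu.2 hv

/-- The claw-deletion sets of the subgraphs of the children of a block combine. -/
theorem not_clawAt_union_biUnion {S₀ : Finset V} {S : BCNode G → Finset V}
    (hS : ∀ y ∈ children (blockCutpointGraph G) ρ (.block B hB),
      ClawFreeOn G (below G ρ y \ S y)) {u : V} (hu : u ∈ below G ρ (.block B hB))
    (huS : u ∉ S₀ ∪ (children (blockCutpointGraph G) ρ (.block B hB)).biUnion S) (huB : u ∉ B) :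
    ¬ ClawAt G (S₀ ∪ (children (blockCutpointGraph G) ρ (.block B hB)).biUnion S)ᶜ u := by
  intro hc
  rcases mem_below_block.1 hu with h | ⟨y, hy, huy⟩
  · exact huB h
  have hy' := mem_children.2 hy
  have hSy : S y ⊆ S₀ ∪ (children (blockCutpointGraph G) ρ (.block B hB)).biUnion S :=
    (Finset.subset_biUnion_of_mem S hy').trans Finset.subset_union_right
  refine hS y hy' u (Finset.mem_sdiff.2 ⟨huy, fun h => huS (hSy h)⟩) (hc.mono fun z hz huz => ?_)
  obtain ⟨v, hv, rfl, hvB⟩ := hy.exists_cut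
  exact Finset.mem_sdiff.2 ⟨mem_below_cut_of_adj hG hconn hT huy (fun h => huB (h ▸ hvB)) huz,
    fun h => Finset.mem_compl.1 hz (hSy h)⟩

theorem sum_union_biUnion_le {S₀ : Finset V} (hS₀ : S₀ ⊆ simplicialVerts G B)
    {S : BCNode G → Finset V} {m : BCNode G → ℕ}
    (hS : ∀ y ∈ children (blockCutpointGraph G) ρ (.block B hB), S y ⊆ below G ρ y)
    (hm : ∀ y ∈ children (blockCutpointGraph G) ρ (.block B hB), ∑ u ∈ S y, w u ≤ m y) :
    ∑ u ∈ S₀ ∪ (children (blockCutpointGraph G) ρ (.block B hB)).biUnion S, w u ≤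
      ∑ u ∈ S₀, w u + ∑ y ∈ children (blockCutpointGraph G) ρ (.block B hB), m y := by
  rw [Finset.sum_union, sum_biUnion_of_subset w (eq_of_mem_below hG hconn hT) hS]
  · exact Nat.add_le_add_left (Finset.sum_le_sum hm) _
  · exact (disjoint_simplicialVerts hG hconn hT).mono hS₀ (Finset.biUnion_mono hS)

variable (hx : IsChild (blockCutpointGraph G) ρ (.cut p hp) (.block B hB))
include hx

/-- The vertices of `B` are sorted by `eq_parent_or`, and `p` lies in no `G_v` because it would then
equal the child `v`. The union is disjoint by `disjoint_simplicialVerts` and `eq_of_mem_below`. -/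
theorem below_block_sdiff_eq : below G ρ (.block B hB) \ {p} = simplicialVerts G B ∪
    (children (blockCutpointGraph G) ρ (.block B hB)).biUnion (below G ρ) := by
  ext u
  simp only [simplicialVerts, Finset.mem_sdiff, Finset.mem_singleton, Finset.mem_union,
    Finset.mem_filter, Finset.mem_biUnion, mem_children]
  constructor
  · rintro ⟨hu, hup⟩
    rcases mem_below_block.1 hu with h | h
    · rcases eq_parent_or hT hx h with h' | h' | ⟨hc, h'⟩
      · exact absurd h' hup
      · exact .inl ⟨h, h'⟩
      · exact .inr ⟨_, h', mem_below_cut_self hG hconn hT hc⟩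
    · exact .inr h
  · rintro (⟨h, h'⟩ | ⟨y, hy, huy⟩)
    · exact ⟨mem_below_of_mem h, fun hup => h' (hup ▸ hp)⟩
    · refine ⟨below_subset hy huy, ?_⟩
      rintro rfl
      obtain ⟨v, hv, rfl, -⟩ := hy.exists_cut
      exact hx.ne_parent hy (eq_of_mem_below_cut hG hconn hT hy huy hx.1).symm

theorem sum_eq_of_subset_below_block {S : Finset V} (hS : S ⊆ below G ρ (.block B hB) \ {p}) :
    ∑ u ∈ S, w u = ∑ u ∈ S ∩ simplicialVerts G B, w u +
      ∑ y ∈ children (blockCutpointGraph G) ρ (.block B hB), ∑ u ∈ S ∩ below G ρ y, w u := by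
  rw [below_block_sdiff_eq hG hconn hT hx] at hS
  rw [sum_inter_biUnion _ _ (eq_of_mem_below hG hconn hT), ← Finset.sum_union,
    ← Finset.inter_union_distrib_left, Finset.inter_eq_left.2 hS]
  exact (disjoint_simplicialVerts hG hconn hT).mono Finset.inter_subset_right
    Finset.inter_subset_right

theorem union_biUnion_subset {S₀ : Finset V} (hS₀ : S₀ ⊆ simplicialVerts G B)
    {S : BCNode G → Finset V}
    (hS : ∀ y ∈ children (blockCutpointGraph G) ρ (.block B hB), S y ⊆ below G ρ y) :
    S₀ ∪ (children (blockCutpointGraph G) ρ (.block B hB)).biUnion S ⊆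
      below G ρ (.block B hB) \ {p} := by
  rw [below_block_sdiff_eq hG hconn hT hx]
  exact Finset.union_subset_union hS₀ (Finset.biUnion_mono hS)

/-- Delete the vertices of `B` other than its parent `p` and, possibly, the child `y₁`. -/
theorem exists_sum_le_except (m : BCNode G → ℕ) (P : V → Prop)
    (hex : ∀ v hv, IsChild (blockCutpointGraph G) ρ (.block B hB) (.cut v hv) →
      ∃ S, (S ⊆ below G ρ (.cut v hv) ∧ ClawFreeOn G (below G ρ (.cut v hv) \ S) ∧
        (P v ∨ v ∈ S)) ∧ ∑ u ∈ S, w u ≤ m (.cut v hv))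
    (hP : ∀ a b, P a → P b → a = b) :
    ∃ S, (S ⊆ below G ρ (.block B hB) \ {p} ∧
      ClawFreeOn G ((below G ρ (.block B hB) \ {p}) \ S) ∧ ∀ u ∈ B \ {p}, P u ∨ u ∈ S) ∧
      ∑ u ∈ S, w u ≤ simplicialWeight G w B +
        ∑ y ∈ children (blockCutpointGraph G) ρ (.block B hB), m y := by
  have hex' : ∀ y ∈ children (blockCutpointGraph G) ρ (.block B hB), ∃ S ⊆ below G ρ y,
      ClawFreeOn G (below G ρ y \ S) ∧ (∀ v ∈ y.verts, P v ∨ v ∈ S) ∧ ∑ u ∈ S, w u ≤ m y := by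
    intro y hy
    rw [mem_children] at hy
    obtain ⟨v, hv, rfl, hvB⟩ := hy.exists_cut
    obtain ⟨S, ⟨h1, h2, h3⟩, h4⟩ := hex v hv hy
    exact ⟨S, h1, h2, fun u hu => Finset.mem_singleton.1 hu ▸ h3, h4⟩
  choose! S h1 h2 h3 h4 using hex'
  have hkeep : ∀ u ∈ B \ {p}, P u ∨ u ∈ simplicialVerts G B ∪
      (children (blockCutpointGraph G) ρ (.block B hB)).biUnion S := by
    intro u hu
    rw [Finset.mem_sdiff, Finset.mem_singleton] at hu
    rcases eq_parent_or hT hx hu.1 with h | h | ⟨hc, h⟩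
    · exact absurd h hu.2
    · exact .inr (Finset.mem_union_left _ (Finset.mem_filter.2 ⟨hu.1, h⟩))
    · have hy := mem_children.2 h
      exact (h3 _ hy u (Finset.mem_singleton_self u)).imp_right fun h =>
        Finset.mem_union_right _ (Finset.subset_biUnion_of_mem S hy h)
  refine ⟨simplicialVerts G B ∪ (children (blockCutpointGraph G) ρ (.block B hB)).biUnion S,
    ⟨union_biUnion_subset hG hconn hT hx subset_rfl h1, fun u hu hc => ?_, hkeep⟩,
    sum_union_biUnion_le hG hconn hT subset_rfl h1 h4⟩
  have hu' := Finset.mem_sdiff.1 hu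
  have hu'' := Finset.mem_sdiff.1 hu'.1
  by_cases huB : u ∈ B
  · have hPu := (hkeep u (Finset.mem_sdiff.2 ⟨huB, hu''.2⟩)).resolve_right hu'.2
    -- Since `P` holds for at most one vertex, an exempted survivor `u` is alone in `B \ {p}`, and
    -- its remaining neighbours lie in its own `G_u`.
    have hnB : ∀ z ∈ (below G ρ (.block B hB) \ {p}) \ (simplicialVerts G B ∪
        (children (blockCutpointGraph G) ρ (.block B hB)).biUnion S), G.Adj u z → z ∉ B := by
      intro z hz huz hzB
      rw [Finset.mem_sdiff, Finset.mem_sdiff] at hz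
      exact huz.ne (hP _ _ hPu
        ((hkeep z (Finset.mem_sdiff.2 ⟨hzB, hz.1.2⟩)).resolve_right hz.2))
    rcases eq_parent_or hT hx huB with h | h | ⟨hcut, hch⟩
    · exact hu''.2 (by simp [h])
    · exact hu'.2 (Finset.mem_union_left _ (Finset.mem_filter.2 ⟨huB, h⟩))
    · have hy := mem_children.2 hch
      have hSy : S (.cut u hcut) ⊆ simplicialVerts G B ∪
          (children (blockCutpointGraph G) ρ (.block B hB)).biUnion S :=
        (Finset.subset_biUnion_of_mem S hy).trans Finset.subset_union_right
      refine h2 _ hy u (Finset.mem_sdiff.2 ⟨mem_below_cut_self hG hconn hT hcut,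
        fun h => hu'.2 (hSy h)⟩) (hc.mono fun z hz huz => ?_)
      have hz' := Finset.mem_sdiff.1 hz
      refine Finset.mem_sdiff.2 ⟨?_, fun h => hz'.2 (hSy h)⟩
      rcases mem_block_or_of_adj hG hconn hT huB (Finset.mem_sdiff.1 hz'.1).1 huz
        with h | ⟨_, -, h⟩
      exacts [absurd h (hnB z hz huz), h]
  · exact not_clawAt_union_biUnion hG hconn hT h2 hu''.1 hu'.2 huB
      (hc.mono fun z hz _ => Finset.mem_compl.2 (Finset.mem_sdiff.1 hz).2)

variable {F : BCNode G → Values}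
  (hF : ∀ v hv, IsChild (blockCutpointGraph G) ρ (.block B hB) (.cut v hv) →
    CutCorrect w ρ v (.cut v hv) (F (.cut v hv)))
include hF

/-- The lower bound for `f₃(b)` and for the first alternative of `f₂(b)`. A deleted child costs at
least `f₁`; a kept one has a companion `b` in the block, which is what `f₃_le` asks for. -/
theorem sum_min_le {S A : Finset V} (hS : S ⊆ below G ρ (.block B hB) \ {p})
    (hA : (below G ρ (.block B hB) \ {p}) \ S ⊆ A) (hcf : ClawFreeOn G A)
    (hb : ∀ v hv, IsChild (blockCutpointGraph G) ρ (.block B hB) (.cut v hv) → v ∉ S →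
      ∃ b ∈ B, b ≠ v ∧ b ∈ A) :
    ∑ y ∈ children (blockCutpointGraph G) ρ (.block B hB), min (F y).f₁ (F y).f₃ ≤
      ∑ u ∈ S, w u := by
  rw [sum_eq_of_subset_below_block hG hconn hT hx hS]
  refine le_trans (Finset.sum_le_sum fun y hy => ?_) (Nat.le_add_left _ _)
  have hsub : below G ρ y ⊆ below G ρ (.block B hB) \ {p} := by
    rw [below_block_sdiff_eq hG hconn hT hx]
    exact (Finset.subset_biUnion_of_mem _ hy).trans Finset.subset_union_right
  rw [mem_children] at hy
  obtain ⟨v, hv, rfl, hvB⟩ := hy.exists_cut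
  by_cases hvS : v ∈ S
  · exact (min_le_left _ _).trans ((hF v hv hy).f₁_le_sum_inter (hcf.mono hA) hvS hsub
      (mem_below_cut_self hG hconn hT hv))
  · obtain ⟨b, hbB, hbv, hbA⟩ := hb v hv hy hvS
    refine (min_le_right _ _).trans ((hF v hv hy).f₃_le B hB hy _ Finset.inter_subset_right
      (fun h => hvS (Finset.mem_inter.1 h).1) b hbB hbv (hcf.mono fun z hz => ?_))
    rw [Finset.mem_sdiff, Finset.mem_inter, Finset.mem_insert] at hz
    rcases hz.1 with rfl | hz'
    · exact hbA
    · exact hA (Finset.mem_sdiff.2 ⟨hsub hz', fun h => hz.2 ⟨h, hz'⟩⟩)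

/-- Take the cheaper option at every child and delete no other vertex of `B`. A set for `f₃(v)`
stays claw-free together with all of `B`, so the choices do not interfere; the vertices of `B` that
are not children see only the clique `B` inside `G_b`. -/
theorem exists_sum_le_min : ∃ S, (S ⊆ below G ρ (.block B hB) ∧
    ClawFreeOn G (below G ρ (.block B hB) \ S) ∧ p ∉ S) ∧
      ∑ u ∈ S, w u ≤ ∑ y ∈ children (blockCutpointGraph G) ρ (.block B hB),
        min (F y).f₁ (F y).f₃ := by
  have hex : ∀ y ∈ children (blockCutpointGraph G) ρ (.block B hB), ∃ S ⊆ below G ρ y,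
      ∑ u ∈ S, w u ≤ min (F y).f₁ (F y).f₃ ∧ ClawFreeOn G (below G ρ y \ S) ∧
      (y.verts ⊆ S ∨ ClawFreeOn G ((below G ρ y ∪ B) \ S)) := by
    intro y hy
    rw [mem_children] at hy
    obtain ⟨v, hv, rfl, hvB⟩ := hy.exists_cut
    rcases min_choice (F (.cut v hv)).f₁ (F (.cut v hv)).f₃ with h | h
    · obtain ⟨S, ⟨h1, h2, h3⟩, h4⟩ := (hF v hv hy).f₁.exists_le
      exact ⟨S, h1, h4.trans h.ge, h2, .inl (by simpa [BCNode.verts] using h3)⟩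
    · obtain ⟨S, h1, h2, h3, h4⟩ := (hF v hv hy).f₃_exists B hB hy
      exact ⟨S, h1, h4.trans h.ge,
        h3.mono (Finset.sdiff_subset_sdiff Finset.subset_union_left subset_rfl), .inr h3⟩
  choose! S h1 h2 h3 h4 using hex
  have hsub := union_biUnion_subset hG hconn hT hx (Finset.empty_subset _) h1
  refine ⟨∅ ∪ (children (blockCutpointGraph G) ρ (.block B hB)).biUnion S,
    ⟨hsub.trans Finset.sdiff_subset, fun u hu hc => ?_, fun h => ?_⟩, ?_⟩
  · have hu' := Finset.mem_sdiff.1 hu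
    by_cases huB : u ∈ B
    · by_cases hch : ∃ hc : IsCutpoint G u,
          IsChild (blockCutpointGraph G) ρ (.block B hB) (.cut u hc)
      · obtain ⟨hcut, hch⟩ := hch
        have hy := mem_children.2 hch
        have hSy : S (.cut u hcut) ⊆
            ∅ ∪ (children (blockCutpointGraph G) ρ (.block B hB)).biUnion S :=
          (Finset.subset_biUnion_of_mem S hy).trans Finset.subset_union_right
        rcases h4 _ hy with h | h
        · exact hu'.2 (hSy (h (Finset.mem_singleton_self u)))
        · refine h u (Finset.mem_sdiff.2 ⟨Finset.mem_union_right _ huB, fun h => hu'.2 (hSy h)⟩)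
            (hc.mono fun z hz huz => ?_)
          rw [Finset.mem_sdiff] at hz
          refine Finset.mem_sdiff.2 ⟨Finset.mem_union.2 ?_, fun h => hz.2 (hSy h)⟩
          rcases mem_block_or_of_adj hG hconn hT huB hz.1 huz with h | ⟨_, -, h⟩
          exacts [.inr h, .inl h]
      · refine not_clawAt_of_cliques {B} id (by simp) ?_ ?_ hc
        · intro D hD
          rw [Finset.mem_singleton.1 hD]
          exact hG B hB
        · intro z hz huz
          rcases mem_block_or_of_adj hG hconn hT huB (Finset.mem_sdiff.1 hz).1 huz
            with h | ⟨h, h', -⟩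
          · exact ⟨B, by simp, h⟩
          · exact absurd ⟨h, h'⟩ hch
    · exact not_clawAt_union_biUnion hG hconn hT h3 hu'.1 hu'.2 huB
        (hc.mono fun z hz _ => Finset.mem_compl.2 (Finset.mem_sdiff.1 hz).2)
  · simpa using hsub h
  · simpa using sum_union_biUnion_le hG hconn hT (Finset.empty_subset _) h1 h2

/-- Only `f₂` needs a case distinction: whether some kept child is the sole survivor of `B \ {p}`.
-/
theorem blockCorrect_step : BlockCorrect w ρ p (.block B hB) (step G w ρ F (.block B hB)) := by
  have hsub : ∀ y ∈ children (blockCutpointGraph G) ρ (.block B hB),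
      below G ρ y ⊆ below G ρ (.block B hB) \ {p} := by
    intro y hy
    rw [below_block_sdiff_eq hG hconn hT hx]
    exact (Finset.subset_biUnion_of_mem _ hy).trans Finset.subset_union_right
  have hp' : ∀ u, ¬ IsCutpoint G u → u ≠ p := fun u hu h => hu (h ▸ hp)
  refine ⟨isMinWeight_of ?_ ?_, isMinWeight_of ?_ ?_, isMinWeight_of ?_ ?_⟩
  · obtain ⟨S, ⟨h1, h2, h3⟩, h4⟩ := exists_sum_le_except (w := w) hG hconn hT hx
      (fun y => (F y).f₁) (fun _ => False) (fun v hv h => by simpa using (hF v hv h).f₁.exists_le)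
      (fun _ _ h => h.elim)
    exact ⟨S, ⟨h1, h2, fun u hu => (h3 u hu).resolve_left id⟩,
      h4.trans_eq (step_block_f₁ F B hB).symm⟩
  · rintro S ⟨hS, hcf, hBS⟩
    rw [step_block_f₁, sum_eq_of_subset_below_block hG hconn hT hx hS]
    refine Nat.add_le_add (le_of_eq ?_) (Finset.sum_le_sum fun y hy => ?_)
    · rw [Finset.inter_eq_right.2]
      · rfl
      · intro u hu
        rw [simplicialVerts, Finset.mem_filter] at hu
        exact hBS (by simp [BCNode.verts, hu.1, hp' u hu.2])
    · have hy' := mem_children.1 hy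
      obtain ⟨v, hv, rfl, hvB⟩ := hy'.exists_cut
      exact (hF v hv hy').f₁_le_sum_inter hcf
        (hBS (by simp [BCNode.verts, hvB, hx.ne_parent hy'])) (hsub _ hy)
        (mem_below_cut_self hG hconn hT hv)
  · rcases step_block_f₂_eq (w := w) F B hB with h | ⟨y, hy, h⟩
    · obtain ⟨S, ⟨h1, h2, h3⟩, h4⟩ := exists_sum_le_min hG hconn hT hx hF
      rw [h]
      refine ⟨S, ⟨fun u hu => ?_, h2.mono ?_⟩, h4⟩
      · rw [Finset.mem_sdiff, Finset.mem_singleton]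
        exact ⟨h1 hu, fun h => h3 (h ▸ hu)⟩
      · exact Finset.sdiff_subset_sdiff Finset.sdiff_subset subset_rfl
    · obtain ⟨v₁, hv₁, rfl, hvB⟩ := (mem_children.1 hy).exists_cut
      -- The exempted vertex is `v₁`: it pays `f₂`, and all other vertices of `B \ {p}` are deleted.
      obtain ⟨S, ⟨h1, h2, -⟩, h4⟩ := exists_sum_le_except (w := w) hG hconn hT hx
        (fun y => if y = .cut v₁ hv₁ then (F y).f₂ else (F y).f₁) (fun v => v = v₁)
        (fun v hv hch => by
          by_cases hvv : v = v₁
          · subst hvv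
            obtain ⟨S, ⟨h1, h2, -⟩, h3⟩ := (hF v hv hch).f₂.exists_le
            exact ⟨S, ⟨h1, h2, .inl rfl⟩, by simpa using h3⟩
          · obtain ⟨S, ⟨h1, h2, h3⟩, h4⟩ := (hF v hv hch).f₁.exists_le
            exact ⟨S, ⟨h1, h2, .inr h3⟩, by simpa [hvv] using h4⟩)
        (fun a b ha hb => ha.trans hb.symm)
      refine ⟨S, ⟨h1, h2⟩, h4.trans_eq ?_⟩
      rw [h, Finset.sdiff_singleton_eq_erase, ← Finset.add_sum_erase _ _ hy, if_pos rfl, add_assoc]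
      congr 2
      exact Finset.sum_congr rfl fun z hz => if_neg (Finset.ne_of_mem_erase hz)
  · rintro S ⟨hS, hcf⟩
    by_cases h : ∃ v hv, IsChild (blockCutpointGraph G) ρ (.block B hB) (.cut v hv) ∧ v ∉ S ∧
        ∀ b ∈ B, b ≠ v → b ≠ p → b ∈ S
    · obtain ⟨v, hv, hch, hvS, hBS⟩ := h
      have hy := mem_children.2 hch
      refine (step_block_f₂_le_of_mem F B hB hy).trans ?_
      rw [sum_eq_of_subset_below_block hG hconn hT hx hS, Finset.sdiff_singleton_eq_erase,
        ← Finset.add_sum_erase _ (fun y => ∑ u ∈ S ∩ below G ρ y, w u) hy, add_assoc]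
      refine Nat.add_le_add (le_of_eq ?_) (Nat.add_le_add ?_ (Finset.sum_le_sum fun z hz => ?_))
      · rw [Finset.inter_eq_right.2]
        · rfl
        · intro u hu
          rw [simplicialVerts, Finset.mem_filter] at hu
          exact hBS u hu.1 (fun h => hu.2 (h ▸ hv)) (hp' u hu.2)
      · refine (hF v hv hch).f₂.le ⟨Finset.inter_subset_right, hcf.mono fun z hz => ?_,
          fun h => hvS (Finset.mem_inter.1 h).1⟩
        rw [Finset.mem_sdiff, Finset.mem_inter] at hz
        exact Finset.mem_sdiff.2 ⟨hsub _ hy hz.1, fun h => hz.2 ⟨h, hz.1⟩⟩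
      · have hzC := Finset.mem_of_mem_erase hz
        have hz' := mem_children.1 hzC
        obtain ⟨v', hv', rfl, hvB'⟩ := hz'.exists_cut
        refine (hF v' hv' hz').f₁_le_sum_inter hcf (hBS v' hvB' ?_ (hx.ne_parent hz'))
          (hsub _ hzC) (mem_below_cut_self hG hconn hT hv')
        rintro rfl
        exact Finset.ne_of_mem_erase hz rfl
    -- Now every kept child has a companion in `B \ {p}`. This includes the case that no child is
    -- kept.
    · push Not at h
      refine (step_block_f₂_le F B hB).trans
        (sum_min_le hG hconn hT hx hF hS subset_rfl hcf fun v hv hch hvS => ?_)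
      obtain ⟨b, hbB, hbv, hbp, hbS⟩ := h v hv hch hvS
      exact ⟨b, hbB, hbv, by simp [mem_below_of_mem hbB, hbp, hbS]⟩
  · rw [step_block_f₃]
    exact exists_sum_le_min hG hconn hT hx hF
  · rintro S ⟨hS, hcf, hpS⟩
    rw [step_block_f₃]
    -- Here `p` survives and is the companion of every kept child.
    refine sum_min_le hG hconn hT hx hF (fun u hu => ?_)
      (Finset.sdiff_subset_sdiff Finset.sdiff_subset subset_rfl) hcf fun v hv hch _ =>
        ⟨p, hx.1, (hx.ne_parent hch).symm, Finset.mem_sdiff.2 ⟨mem_below_of_mem hx.1, hpS⟩⟩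
    rw [Finset.mem_sdiff, Finset.mem_singleton]
    exact ⟨hS hu, fun h => hpS (h ▸ hu)⟩

end BlockStep

/-! ### From the nodes to the theorem -/

section Main

open scoped Classical

variable {V : Type u} {G : SimpleGraph V} {w : V → ℕ}

theorem isClawDeletionSet_iff {U S : Finset V} :
    IsClawDeletionSet G U S ↔ S ⊆ U ∧ ClawFreeOn G (U \ S) := by
  rw [IsClawDeletionSet, isClawFree_induce_iff]

theorem IsMinWeight.congr {P Q : Finset V → Prop} {m : ℕ} (h : IsMinWeight w P m)
    (hPQ : ∀ S, P S ↔ Q S) : IsMinWeight w Q m := by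
  rwa [show Q = P from funext fun S => propext (hPQ S).symm]

theorem IsMinWeight.min {P Q R : Finset V → Prop} {m n : ℕ} (h : IsMinWeight w P m)
    (h' : IsMinWeight w Q n) (hR : ∀ S, R S ↔ P S ∨ Q S) : IsMinWeight w R (min m n) := by
  have hset : {k | ∃ S, R S ∧ k = ∑ v ∈ S, w v} =
      {k | ∃ S, P S ∧ k = ∑ v ∈ S, w v} ∪ {k | ∃ S, Q S ∧ k = ∑ v ∈ S, w v} := by
    ext k
    simp only [hR, or_and_right, exists_or]
    rfl
  unfold IsMinWeight
  rw [hset]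
  exact h.union h'

variable {ρ : BCNode G}

theorem parentVerts_eq (hT : IsRootedTree (blockCutpointGraph G) ρ) {x y : BCNode G}
    (hx : IsChild (blockCutpointGraph G) ρ y x) : parentVerts G ρ x = y.verts := by
  rw [parentVerts, hT.parent_eq hx]

variable [Fintype V]

theorem belowPlus_eq (hT : IsRootedTree (blockCutpointGraph G) ρ) {B : Finset V}
    {hB : IsBlock G B} {x : BCNode G} (hx : IsChild (blockCutpointGraph G) ρ (.block B hB) x) :
    belowPlus G ρ x = below G ρ x ∪ B := by
  ext u
  rw [belowPlus, hT.parent_eq hx, Finset.mem_union, mem_below]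
  simp only [vertsOf, Finset.mem_filter, Finset.mem_univ, true_and, Set.mem_insert_iff,
    BCNode.block.injEq]
  constructor
  · rintro ⟨D, hD, rfl | h, hu⟩
    exacts [.inr hu, .inl ⟨D, hD, h, hu⟩]
  · rintro (⟨D, hD, h, hu⟩ | hu)
    exacts [⟨D, hD, .inr h, hu⟩, ⟨B, hB, .inl rfl, hu⟩]

/-- Intersecting `S` with `G_v` only lowers the weight and leaves a surviving `b` in the parent
block. Conversely, a set inside `G_v` avoiding `v` misses the parent block, which meets `G_v` only
in `v`. -/
theorem CutCorrect.isMinWeight_f₃ (hT : IsRootedTree (blockCutpointGraph G) ρ) {B : Finset V}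
    {hB : IsBlock G B} {v : V} {x : BCNode G} {Z : Values} (hZ : CutCorrect w ρ v x Z)
    (hx : IsChild (blockCutpointGraph G) ρ (.block B hB) x)
    (hD : ∀ b ∈ B, b ∈ below G ρ x → b = v) (hne : ∃ b ∈ B, b ≠ v) :
    IsMinWeight w (fun S => IsClawDeletionSet G (belowPlus G ρ x) S ∧ v ∉ S ∧
      ¬ ((parentVerts G ρ x : Set V) \ {v} ⊆ S)) Z.f₃ := by
  simp only [isClawDeletionSet_iff, belowPlus_eq hT hx, parentVerts_eq hT hx, BCNode.verts]
  refine isMinWeight_of ?_ ?_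
  · obtain ⟨S, h1, h2, h3, h4⟩ := hZ.f₃_exists B hB hx
    obtain ⟨b, hb, hbv⟩ := hne
    exact ⟨S, ⟨⟨h1.trans Finset.subset_union_left, h3⟩, h2,
      fun h => hbv (hD b hb (h1 (h ⟨hb, hbv⟩)))⟩, h4⟩
  · rintro S ⟨⟨hS, hcf⟩, hvS, hBS⟩
    obtain ⟨b, ⟨hb, hbv⟩, hbS⟩ := Set.not_subset.1 hBS
    refine (hZ.f₃_le B hB hx (S ∩ below G ρ x) Finset.inter_subset_right
      (fun h => hvS (Finset.mem_inter.1 h).1) b hb hbv (hcf.mono fun z hz => ?_)).trans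
      (Finset.sum_le_sum_of_subset Finset.inter_subset_left)
    rw [Finset.mem_sdiff, Finset.mem_inter, Finset.mem_insert] at hz
    rw [Finset.mem_sdiff, Finset.mem_union]
    rcases hz.1 with rfl | hz'
    · exact ⟨.inr hb, hbS⟩
    · exact ⟨.inl hz', fun h => hz.2 ⟨h, hz'⟩⟩

/-- The values at a node have the intended meaning. -/
def NodeCorrect (w : V → ℕ) (ρ : BCNode G) : BCNode G → Values → Prop
  | .cut v hv, Z => CutCorrect w ρ v (.cut v hv) Z
  | .block B hB, Z => ∀ p hp, IsChild (blockCutpointGraph G) ρ (.cut p hp) (.block B hB) →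
      BlockCorrect w ρ p (.block B hB) Z

theorem nodeCorrect_values [Nontrivial V] (hG : IsBlockGraph G) (hconn : G.Connected)
    (hT : IsRootedTree (blockCutpointGraph G) ρ) (x : BCNode G) :
    NodeCorrect w ρ x (values G w ρ x) := by
  induction hn : coheight (blockCutpointGraph G) ρ x using Nat.strong_induction_on
    generalizing x with
  | _ n ih =>
    subst hn
    have ih' : ∀ y ∈ children (blockCutpointGraph G) ρ x, NodeCorrect w ρ y (values G w ρ y) :=
      fun y hy => ih _ (coheight_lt hy) y rfl
    rw [values_eq]
    rcases x with ⟨v, hv⟩ | ⟨B, hB⟩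
    · refine cutCorrect_step hG hconn hT (fun y hy => ?_) fun y hy => ?_
      · have h := ih' y hy
        have hy' := mem_children.1 hy
        obtain ⟨B, hB, rfl, -⟩ := hy'.exists_block
        exact h v hv hy'
      · obtain ⟨B, hB, rfl, -⟩ := (mem_children.1 hy).exists_block
        rw [values_eq]
        exact step_block_f₃_le_f₁ _ B hB
    · intro p hp hx
      exact blockCorrect_step hG hconn hT hx fun v hv hch => ih' _ (mem_children.2 hch)

end Main

end ClawDeletion

theorem mainTheorem2 {V : Type*} [Fintype V] (G : SimpleGraph V) (w : V → ℕ)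
    (hw : ∀ v, 0 < w v) (hconn : G.Connected) (hblock : IsBlockGraph G) (hne : G ≠ ⊤) :
    (∃ r, IsCutpoint G r) ∧
    ∀ (r : V) (hr : IsCutpoint G r) (ρ : BCNode G), ρ = BCNode.cut r hr →
      -- the values at the cutpoint nodes are correct
      (∀ (v : V) (hv : IsCutpoint G v) (x : BCNode G), x = BCNode.cut v hv →
        IsMinWeight w (fun S => IsClawDeletionSet G (below G ρ x) S ∧ v ∈ S)
          (values G w ρ x).f₁ ∧
        IsMinWeight w (fun S => IsClawDeletionSet G (below G ρ x) S ∧ v ∉ S)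
          (values G w ρ x).f₂ ∧
        (v ≠ r →
          IsMinWeight w (fun S => IsClawDeletionSet G (belowPlus G ρ x) S ∧ v ∉ S ∧
            ¬ ((parentVerts G ρ x : Set V) \ {v} ⊆ S))
            (values G w ρ x).f₃)) ∧
      -- the values at the block nodes are correct
      (∀ (B : Finset V) (hB : IsBlock G B) (x : BCNode G), x = BCNode.block B hB →
        IsMinWeight w (fun S => IsClawDeletionSet G (belowMinus G ρ x) S ∧
            (B : Set V) \ parentVerts G ρ x ⊆ S)
          (values G w ρ x).f₁ ∧
        IsMinWeight w (fun S => IsClawDeletionSet G (belowMinus G ρ x) S)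
          (values G w ρ x).f₂ ∧
        IsMinWeight w (fun S => IsClawDeletionSet G (below G ρ x) S ∧
            Disjoint (parentVerts G ρ x) S)
          (values G w ρ x).f₃) ∧
      -- the value at the root solves the problem for the whole graph
      IsMinWeight w (fun S => IsClawDeletionSet G Finset.univ S)
        (min (values G w ρ ρ).f₁ (values G w ρ ρ).f₂) := by
  classical
  have hcut := exists_isCutpoint hblock hconn hne
  refine ⟨hcut, ?_⟩
  rintro r hr ρ rfl
  have : Nontrivial V := by
    obtain ⟨a, b, ha, -⟩ := hr.exists_not_joinedAvoiding hconn
    exact ⟨a, r, ha⟩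
  have hT := isRootedTree_blockCutpointGraph hblock hconn hr
  have hval := nodeCorrect_values (w := w) hblock hconn hT
  have hdel : ∀ (U S : Finset V) (Q : Prop), (S ⊆ U ∧ ClawFreeOn G (U \ S) ∧ Q) ↔
      (IsClawDeletionSet G U S ∧ Q) := fun U S Q => by rw [isClawDeletionSet_iff, and_assoc]
  refine ⟨?_, ?_, ?_⟩
  · rintro v hv x rfl
    have h : CutCorrect w _ v _ _ := hval (.cut v hv)
    refine ⟨h.f₁.congr fun S => hdel _ _ _, h.f₂.congr fun S => hdel _ _ _, fun hvr => ?_⟩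
    obtain ⟨y, hy⟩ := hT.exists_isChild (x := .cut v hv) (by simpa using hvr)
    obtain ⟨B, hB, rfl, -⟩ := hy.exists_block_parent
    exact h.isMinWeight_f₃ hT hy (fun b hb hbD => eq_of_mem_below_cut hblock hconn hT hy hbD hb)
      (hB.exists_ne hconn v)
  · rintro B hB x rfl
    -- The root is a cutpoint, so every block has a parent.
    obtain ⟨y, hy⟩ := hT.exists_isChild (x := .block B hB) (by simp)
    obtain ⟨p, hp, rfl, -⟩ := hy.exists_cut_parent
    have h : BlockCorrect w _ p _ _ := hval (.block B hB) p hp hy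
    have hminus : belowMinus G (.cut r hr) (.block B hB) =
        below G (.cut r hr) (.block B hB) \ {p} := by
      rw [belowMinus, parentVerts_eq hT hy, BCNode.verts]
    rw [hminus, parentVerts_eq hT hy]
    refine ⟨h.f₁.congr fun S => ?_, h.f₂.congr fun S => isClawDeletionSet_iff.symm,
      h.f₃.congr fun S => ?_⟩
    · rw [hdel, ← Finset.coe_subset, Finset.coe_sdiff]
      rfl
    · rw [hdel, BCNode.verts, Finset.disjoint_singleton_left]
  · have h : CutCorrect w _ r _ _ := hval (.cut r hr)
    -- `G_r` is all of `G`, and a deletion set either contains `r` or does not.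
    rw [← below_root hconn hT]
    refine h.f₁.min h.f₂ fun S => ?_
    rw [hdel, hdel, ← and_or_left, and_iff_left (Classical.em _)]
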